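/- Let $k\ge 1$, and let $Q$ be a connected, paracompact (Hausdorff) smooth manifold of finite dimension, without boundary. Let $T^1_kQ=TQ\oplus\cdots\oplus TQ$ ($k$ copies) with projection $\tau\colon T^1_kQ\to Q$ and induced coordinates $(q^i,v^i_A)$. For a smooth function $L\colon T^1_kQ\to\mathbb{R}$ (a Lagrangian) put $\theta_L^A=dL\circ S^A$ and $\omega_L^A=-d\theta_L^A$ for $A=1,\dots,k$, where $S^A=\frac{\partial}{\partial v^i_A}\otimes dq^i$ are the canonical endomorphisms of $T(T^1_kQ)$, and $E_L=\Delta(L)-L$, where $\Delta=v^i_A\frac{\partial}{\partial v^i_A}$ is the Liouville vector field. Let $\mathfrak{X}^k_L(T^1_kQ)$ be the set of $k$-tuples $(\Gamma_1,\dots,\Gamma_k)$ of smooth vector fields on $T^1_kQ$ with $\sum_{A=1}^k i(\Gamma_A)\omega_L^A=dE_L$. The Lagrangian $L$ is regular if the matrix $\left(\frac{\partial^2L}{\partial v^i_A\partial v^j_B}\right)$ is non-singular at every point. Two Lagrangians $L_1,L_2$ are gauge equivalent if $\omega_{L_1}^A=\omega_{L_2}^A$ for $A=1,\dots,k$ and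 $\mathfrak{X}^k_{L_1}(T^1_kQ)=\mathfrak{X}^k_{L_2}(T^1_kQ)$. Let $L_1,L_2\in C^\infty(T^1_kQ)$ be regular. Then $L_1$ and $L_2$ are gauge equivalent if and only if there are smooth closed $1$-forms $\alpha^1,\dots,\alpha^k$ on $Q$ and a constant $c\in\mathbb{R}$ such that $L_1=L_2+\hat\alpha+c$, where $\hat\alpha(v_{1},\dots,v_{k})=\sum_{A=1}^k\alpha^A_q(v_{A})$ for $v_1,\dots,v_k\in T_qQ$, $q\in Q$. -/

import Mathlib

open scoped Manifold ContDiff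

noncomputable section

namespace KSymplectic

/-! ### The exterior derivative of a 1-form on a manifold without boundary -/

section ExteriorDerivative

variable {F : Type*} [NormedAddCommGroup F] [NormedSpace ℝ F]
  {H : Type*} [TopologicalSpace H] (I : ModelWithCorners ℝ F H)
  {M : Type*} [TopologicalSpace M] [ChartedSpace H M]

/-- The derivative at `x` of the preferred chart at `x`. -/
def chartDeriv (x : M) : TangentSpace I x →L[ℝ] F :=
  mfderiv I 𝓘(ℝ, F) (extChartAt I x) x

/-- The derivative at `y` of the inverse of the preferred chart at `x`. -/
def chartSymmDeriv (x : M) (y : F) : F →L[ℝ] TangentSpace I ((extChartAt I x).symm y) :=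
  mfderiv 𝓘(ℝ, F) I (extChartAt I x).symm y

/-- The expression of a 1-form `α` in the preferred chart at `x`: the pullback of `α` to the model
space by the inverse of the chart. -/
def chartForm (α : (x : M) → TangentSpace I x →L[ℝ] ℝ) (x : M) (y : F) : F →L[ℝ] ℝ :=
  (α ((extChartAt I x).symm y)).comp (chartSymmDeriv I x y)

/-- The exterior derivative `dα` of a (smooth) 1-form on a manifold without boundary: `dα` at `x` is
obtained by taking the exterior derivative of the expression of `α` in the chart at `x`, and pulling
it back by the chart. It is normalised by
`dα(X, Y) = X(α(Y)) - Y(α(X)) - α([X, Y])`. -/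
def extDer (α : (x : M) → TangentSpace I x →L[ℝ] ℝ) (x : M) :
    TangentSpace I x [⋀^Fin 2]→L[ℝ] ℝ :=
  (extDeriv (fun y : F => ContinuousAlternatingMap.ofSubsingleton ℝ F ℝ (0 : Fin 1)
    (chartForm I α x y)) (extChartAt I x x)).compContinuousLinearMap
      (chartDeriv I x)

end ExteriorDerivative

variable (k : ℕ) (E : Type*) [NormedAddCommGroup E] [NormedSpace ℝ E]

/-! ### The tangent bundle of `k¹`-velocities -/

section VelocityBundle

variable {Q : Type*} [TopologicalSpace Q] [ChartedSpace E Q]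

/-- The fibre `T_qQ ⊕ ⋯ ⊕ T_qQ` (`k` copies) of the bundle of `k¹`-velocities. -/
def VelocitySpace (q : Q) : Type _ := Fin k → TangentSpace 𝓘(ℝ, E) q

instance (q : Q) : AddCommGroup (VelocitySpace k E q) :=
  inferInstanceAs (AddCommGroup (Fin k → TangentSpace 𝓘(ℝ, E) q))

instance (q : Q) : Module ℝ (VelocitySpace k E q) :=
  inferInstanceAs (Module ℝ (Fin k → TangentSpace 𝓘(ℝ, E) q))

instance (q : Q) : TopologicalSpace (VelocitySpace k E q) :=
  inferInstanceAs (TopologicalSpace (Fin k → TangentSpace 𝓘(ℝ, E) q))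

variable (Q)

/-- The Whitney sum `T¹ₖQ = TQ ⊕ ⋯ ⊕ TQ` of `k` copies of the tangent bundle, as a set. -/
abbrev VelocityBundle : Type _ :=
  Bundle.TotalSpace (Fin k → E) (VelocitySpace k E : Q → Type _)

variable [IsManifold 𝓘(ℝ, E) 1 Q]

/-- Auxiliary: the action of an endomorphism of `E` on each component of `Fin k → E`, as a
continuous linear function of the endomorphism. -/
def diagCLM : (E →L[ℝ] E) →L[ℝ] ((Fin k → E) →L[ℝ] (Fin k → E)) :=
  ∑ A : Fin k, (ContinuousLinearMap.compL ℝ (Fin k → E) E (Fin k → E)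
    (ContinuousLinearMap.single ℝ (fun _ : Fin k => E) A)).comp
      ((ContinuousLinearMap.compL ℝ (Fin k → E) E E).flip (ContinuousLinearMap.proj A))

theorem diagCLM_apply (f : E →L[ℝ] E) (v : Fin k → E) (A : Fin k) :
    diagCLM k E f v A = f (v A) := by
  simp [diagCLM, Finset.sum_apply, Pi.single_apply]

/-- The Whitney sum of `k` copies of the tangent bundle as a vector bundle: over the domains of the
charts of `Q`, the coordinate changes are those of `TQ` acting on each of the `k` components. -/
def velocityCore : VectorBundleCore ℝ Q (Fin k → E) (atlas E Q) where
  baseSet i := (tangentBundleCore 𝓘(ℝ, E) Q).baseSet i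
  isOpen_baseSet i := (tangentBundleCore 𝓘(ℝ, E) Q).isOpen_baseSet i
  indexAt := (tangentBundleCore 𝓘(ℝ, E) Q).indexAt
  mem_baseSet_at := (tangentBundleCore 𝓘(ℝ, E) Q).mem_baseSet_at
  coordChange i j x := ContinuousLinearMap.piMap
    (fun _ : Fin k => (tangentBundleCore 𝓘(ℝ, E) Q).coordChange i j x)
  coordChange_self i x hx v := by
    ext A
    exact (tangentBundleCore 𝓘(ℝ, E) Q).coordChange_self i x hx (v A)
  continuousOn_coordChange i j := by
    have h := (diagCLM k E).continuous.comp_continuousOn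
      ((tangentBundleCore 𝓘(ℝ, E) Q).continuousOn_coordChange i j)
    refine h.congr fun x _ => ?_
    ext v A
    simp [diagCLM_apply]
  coordChange_comp i j l x hx v := by
    ext A
    exact (tangentBundleCore 𝓘(ℝ, E) Q).coordChange_comp i j l x hx (v A)

instance : TopologicalSpace (VelocityBundle k E Q) :=
  inferInstanceAs (TopologicalSpace (velocityCore k E Q).TotalSpace)

instance : FiberBundle (Fin k → E) (VelocitySpace k E : Q → Type _) :=
  inferInstanceAs (FiberBundle (Fin k → E) (velocityCore k E Q).Fiber)

instance : VectorBundle ℝ (Fin k → E) (VelocitySpace k E : Q → Type _) :=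
  inferInstanceAs (VectorBundle ℝ (Fin k → E) (velocityCore k E Q).Fiber)

instance [IsManifold 𝓘(ℝ, E) ∞ Q] :
    ContMDiffVectorBundle ∞ (Fin k → E) (VelocitySpace k E : Q → Type _) 𝓘(ℝ, E) := by
  have h1 : IsManifold 𝓘(ℝ, E) (∞ + 1) Q := by assumption
  have h2 : (tangentBundleCore 𝓘(ℝ, E) Q).IsContMDiff 𝓘(ℝ, E) ∞ := tangentBundleCore.isContMDiff
  have h3 : (velocityCore k E Q).IsContMDiff 𝓘(ℝ, E) ∞ := by
    refine ⟨fun i j => ?_⟩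
    have h := (diagCLM k E).contMDiff (n := ∞) |>.comp_contMDiffOn
      ((tangentBundleCore 𝓘(ℝ, E) Q).contMDiffOn_coordChange 𝓘(ℝ, E) i j)
    refine h.congr fun x _ => ?_
    ext v A
    simp [velocityCore, diagCLM_apply]
  exact (velocityCore k E Q).instContMDiffVectorBundle

end VelocityBundle

/-! ### Canonical structures on `T¹ₖQ` -/

/-- The model of `T¹ₖQ`. -/
abbrev velocityModel : ModelWithCorners ℝ (E × (Fin k → E)) (ModelProd E (Fin k → E)) :=
  𝓘(ℝ, E).prod 𝓘(ℝ, Fin k → E)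

section Canonical

variable {Q : Type*} [TopologicalSpace Q] [ChartedSpace E Q] [IsManifold 𝓘(ℝ, E) 1 Q]

variable {k E} in
/-- The inclusion of the fibre `(T_qQ)^k` in `T¹ₖQ`. -/
def fibreIncl (q : Q) (v : Fin k → E) : VelocityBundle k E Q := ⟨q, v⟩

variable {k E} in
/-- The vertical lift at `w = (v_1, …, v_k)` of `(u_1, …, u_k) ∈ (T_qQ)^k`, that is, the tangent
vector at `s = 0` of the curve `s ↦ (v_1 + s u_1, …, v_k + s u_k)`. -/
def verticalLift (w : VelocityBundle k E Q) :
    (Fin k → E) →L[ℝ] TangentSpace (velocityModel k E) w :=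
  mfderiv 𝓘(ℝ, Fin k → E) (velocityModel k E) (fibreIncl (k := k) (E := E) w.1) w.2

variable {k E} in
/-- The derivative `τ_*` at `w` of the projection `τ : T¹ₖQ → Q`. -/
def projDeriv (w : VelocityBundle k E Q) :
    TangentSpace (velocityModel k E) w →L[ℝ] TangentSpace 𝓘(ℝ, E) w.1 :=
  mfderiv (velocityModel k E) 𝓘(ℝ, E) (fun z : VelocityBundle k E Q => z.1) w

variable {k E} in
/-- The canonical `k`-tangent structure `(S¹, …, Sᵏ)`: `S^A(w)(Z)` is the vertical `A`-lift of
`τ_* Z`, that is, the vertical lift of the vector with `A`-th component `τ_* Z` and the other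
components equal to zero. -/
def canonicalEndo (A : Fin k) (w : VelocityBundle k E Q) :
    TangentSpace (velocityModel k E) w →L[ℝ] TangentSpace (velocityModel k E) w :=
  (verticalLift w).comp ((ContinuousLinearMap.single ℝ (fun _ : Fin k => E) A).comp
    (projDeriv w))

variable {k E} in
/-- The Liouville vector field `Δ`: at `w` it is the tangent vector at `s = 0` of the curve
`s ↦ eˢ w`, that is, the vertical lift of `w` at `w`. -/
def liouville (w : VelocityBundle k E Q) : TangentSpace (velocityModel k E) w :=
  verticalLift w w.2

/-! ### Lagrangian `k`-symplectic formalism -/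

variable {k E}

/-- The differential of a function on `T¹ₖQ`. -/
def differential (f : VelocityBundle k E Q → ℝ) (w : VelocityBundle k E Q) :
    TangentSpace (velocityModel k E) w →L[ℝ] ℝ :=
  mfderiv (velocityModel k E) 𝓘(ℝ, ℝ) f w

/-- The 1-form `θ_L^A = dL ∘ S^A`. -/
def thetaL (L : VelocityBundle k E Q → ℝ) (A : Fin k) (w : VelocityBundle k E Q) :
    TangentSpace (velocityModel k E) w →L[ℝ] ℝ :=
  (differential L w).comp (canonicalEndo A w)

/-- The 2-form `ω_L^A = -dθ_L^A`. -/
def omegaL (L : VelocityBundle k E Q → ℝ) (A : Fin k) (w : VelocityBundle k E Q) :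
    TangentSpace (velocityModel k E) w [⋀^Fin 2]→L[ℝ] ℝ :=
  -extDer (velocityModel k E) (thetaL L A) w

/-- The energy `E_L = Δ(L) - L`. -/
def energyL (L : VelocityBundle k E Q → ℝ) (w : VelocityBundle k E Q) : ℝ :=
  differential L w (liouville w) - L w

/-- A Lagrangian is regular if its fibre Hessian `∂²L/∂v^i_A ∂v^j_B` is non-singular at every
point. -/
def IsRegular (L : VelocityBundle k E Q → ℝ) : Prop :=
  ∀ (w : VelocityBundle k E Q) (u : Fin k → E),
    (∀ u' : Fin k → E, fderiv ℝ (fderiv ℝ (fun v : Fin k → E => L (fibreIncl w.1 v))) w.2 u u' = 0) → u = 0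

end Canonical

section Gauge

variable {k E}
variable {Q : Type*} [TopologicalSpace Q] [ChartedSpace E Q] [IsManifold 𝓘(ℝ, E) ∞ Q]

/-- The set `𝔛ᵏ_L(T¹ₖQ)` of the (smooth) `k`-vector fields `(Γ_1, …, Γ_k)` on `T¹ₖQ` such that
`∑_A i(Γ_A) ω_L^A = dE_L`. -/
def solutionFields (L : VelocityBundle k E Q → ℝ) :
    Set (Fin k → (w : VelocityBundle k E Q) → TangentSpace (velocityModel k E) w) :=
  {Γ | (∀ A, ContMDiff (velocityModel k E) (velocityModel k E).tangent ∞
        (fun w => (⟨w, Γ A w⟩ : TangentBundle (velocityModel k E) (VelocityBundle k E Q)))) ∧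
      ∀ (w : VelocityBundle k E Q) (Z : TangentSpace (velocityModel k E) w),
        ∑ A, omegaL L A w ![Γ A w, Z] = differential (energyL L) w Z}

/-- Gauge equivalence of Lagrangians. -/
structure GaugeEquivalent (L₁ L₂ : VelocityBundle k E Q → ℝ) : Prop where
  omega_eq : ∀ A, omegaL L₁ A = omegaL L₂ A
  solutionFields_eq : solutionFields L₁ = solutionFields L₂

/-- A 1-form on `Q` is smooth if it is a smooth section of the cotangent bundle. -/
def IsSmoothForm (α : (q : Q) → TangentSpace 𝓘(ℝ, E) q →L[ℝ] ℝ) : Prop :=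
  ContMDiff 𝓘(ℝ, E) (𝓘(ℝ, E).prod 𝓘(ℝ, E →L[ℝ] ℝ)) ∞
    (fun q => (⟨q, α q⟩ : Bundle.TotalSpace (E →L[ℝ] ℝ)
      (fun q : Q => TangentSpace 𝓘(ℝ, E) q →L[ℝ] Bundle.Trivial Q ℝ q)))

/-- The function `α̂(v_1, …, v_k) = ∑_A α^A(v_A)` on `T¹ₖQ` defined by 1-forms `α^1, …, α^k`. -/
def hat (α : Fin k → (q : Q) → TangentSpace 𝓘(ℝ, E) q →L[ℝ] ℝ) (w : VelocityBundle k E Q) : ℝ :=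
  ∑ A, α A w.1 (w.2 A)

end Gauge

end KSymplectic

end

open Set Topology Filter Bundle

/-! ### Topological preliminaries -/

/-! Put `f = L₁ - L₂`. In a chart induced from `Q`, each `S^A` is the constant nilpotent matrix `J_A
= vertEndo k E A`, so `ω_L^A(X, Z) = D²L(Z, J_A X) - D²L(X, J_A Z)`, which is linear in `L`. Hence
`ω_{L₁}^A = ω_{L₂}^A` for all `A` means that every `(X, Z) ↦ D²f(X, J_A Z)` is symmetric
(`omegaL_eq_iff`). With one vertical argument, which `J_A` kills, this says that the fibre Hessian
of `f` vanishes, so `f = α̂ + g ∘ τ` with `g` the restriction of `f` to the zero section; with two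
horizontal arguments it says `dα^A = 0`. Conversely, `dα^A = 0` gives back the symmetry.

What remains is `g`. The Liouville field reproduces functions linear on the fibres, so `E_{L₁} =
E_{L₂} - g ∘ τ` (`energyL_eq_sub_of_affine`). A common solution `Γ` has the same contraction with
both families of forms; hence `dE_{L₁} = dE_{L₂}`, `dg = 0`, and `g` is constant because `Q` is
connected. In the other direction a constant `g` does not change `dE`, so the two equations
coincide.

The argument needs at least one solution (`solutionFields_nonempty`). Regularity makes the common
kernel of the `ω_L^A` trivial, so `(Γ_A) ↦ ∑ i(Γ_A) ω_L^A` is pointwise onto the cotangent space.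
Smooth local solutions follow, and since the equation is affine in `Γ` they are glued by a partition
of unity, for which `T¹ₖQ` must be Hausdorff and σ-compact. -/

theorem LocallyFinite.exists_finite_cover_step {X ι : Type*} [TopologicalSpace X]
    {V : ι → Set X} (hV : ∀ i, IsOpen (V i)) (hcover : ⋃ i, V i = univ)
    (hcl : ∀ i, IsCompact (closure (V i))) (hfin : LocallyFinite V) {K : Set X}
    (hK : IsCompact K) :
    ∃ K' : Set X, IsCompact K' ∧ K ⊆ K' ∧ ∀ i, (V i ∩ K).Nonempty → V i ⊆ interior K' := by
  have hf : {i | (V i ∩ K).Nonempty}.Finite := hfin.finite_nonempty_inter_compact hK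
  -- By local finiteness only finitely many members meet `K`, so the union of their closures is
  -- compact.
  refine ⟨⋃ i ∈ {i | (V i ∩ K).Nonempty}, closure (V i), hf.isCompact_biUnion fun i _ => hcl i,
    fun x hx => ?_, fun i hi => ?_⟩
  · obtain ⟨i, hi⟩ := mem_iUnion.1 (hcover.symm ▸ mem_univ x : x ∈ ⋃ i, V i)
    exact mem_biUnion (show i ∈ {i | (V i ∩ K).Nonempty} from ⟨x, hi, hx⟩) (subset_closure hi)
  · exact interior_maximal (subset_closure.trans
      (subset_biUnion_of_mem (u := fun i => closure (V i)) hi)) (hV i)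

/-- A connected, locally compact, paracompact space is σ-compact. -/
theorem sigmaCompactSpace_of_connected_paracompact (X : Type*) [TopologicalSpace X]
    [LocallyCompactSpace X] [T2Space X] [ParacompactSpace X] [ConnectedSpace X] :
    SigmaCompactSpace X := by
  have hnhds : ∀ x : X, ∃ U : Set X, IsOpen U ∧ x ∈ U ∧ IsCompact (closure U) :=
    fun x => exists_isOpen_mem_isCompact_closure x
  choose U hUo hxU hUc using hnhds
  obtain ⟨V, hVo, hVcover, hVfin, hVU⟩ := precise_refinement U hUo
    (iUnion_eq_univ_iff.2 fun x => ⟨x, hxU x⟩)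
  have hVc : ∀ i, IsCompact (closure (V i)) := fun i =>
    (hUc i).of_isClosed_subset isClosed_closure (closure_mono (hVU i))
  choose! next hnc hsub hnext using fun (K : Set X) (hK : IsCompact K) =>
    hVfin.exists_finite_cover_step hVo hVcover hVc hK
  obtain ⟨x₀⟩ : Nonempty X := inferInstance
  let K : ℕ → Set X := fun n => next^[n] {x₀}
  have hKs : ∀ n, K (n + 1) = next (K n) := fun n => Function.iterate_succ_apply' next n _
  have hKc : ∀ n, IsCompact (K n) := by
    intro n
    induction n with
    | zero => exact isCompact_singleton
    | succ n ih => rw [hKs]; exact hnc _ ih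
  have hVK : ∀ n i, (V i ∩ K n).Nonempty → V i ⊆ interior (K (n + 1)) := fun n i hi => by
    rw [hKs]; exact hnext _ (hKc n) i hi
  have hVmem : ∀ x, ∃ i, x ∈ V i := fun x => iUnion_eq_univ_iff.1 hVcover x
  -- A member of the cover that meets `K n` lies in `K (n + 1)`. Around a limit point this gives
  -- closedness, around a point of `K n` openness; connectedness then makes the exhaustion
  -- everything.
  have hclopen : IsClopen (⋃ n, K n) := by
    constructor
    · refine isClosed_of_closure_subset fun x hx => ?_
      obtain ⟨i, hi⟩ := hVmem x
      obtain ⟨y, hyV, hy⟩ := mem_closure_iff.1 hx (V i) (hVo i) hi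
      obtain ⟨n, hn⟩ := mem_iUnion.1 hy
      exact mem_iUnion.2 ⟨n + 1, interior_subset (hVK n i ⟨y, hyV, hn⟩ hi)⟩
    · refine isOpen_iff_mem_nhds.2 fun x hx => ?_
      obtain ⟨n, hn⟩ := mem_iUnion.1 hx
      obtain ⟨i, hi⟩ := hVmem x
      exact mem_of_superset ((hVo i).mem_nhds hi) fun y hy =>
        mem_iUnion.2 ⟨n + 1, interior_subset (hVK n i ⟨x, hi, hn⟩ hy)⟩
  have huniv := hclopen.eq_univ ⟨x₀, mem_iUnion.2 ⟨0, rfl⟩⟩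
  exact ⟨⟨K, hKc, huniv⟩⟩

/-- The total space of a fibre bundle with Hausdorff base and fibre is Hausdorff. -/
theorem FiberBundle.t2Space_totalSpace {B F : Type*} [TopologicalSpace B] [TopologicalSpace F]
    (V : B → Type*) [TopologicalSpace (TotalSpace F V)] [∀ b, TopologicalSpace (V b)]
    [FiberBundle F V] [T2Space B] [T2Space F] : T2Space (TotalSpace F V) := by
  refine ⟨fun x y hxy => ?_⟩
  by_cases h : x.proj = y.proj
  · let e := trivializationAt F V x.proj
    have hx : x ∈ e.source := e.mem_source.2 (mem_baseSet_trivializationAt F V _)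
    have hy : y ∈ e.source := e.mem_source.2 (h ▸ mem_baseSet_trivializationAt F V x.proj)
    obtain ⟨u, v, hu, hv, hxu, hyv, huv⟩ := t2_separation (e.injOn.ne hx hy hxy)
    exact ⟨e.source ∩ e ⁻¹' u, e.source ∩ e ⁻¹' v,
      e.toOpenPartialHomeomorph.isOpen_inter_preimage hu,
      e.toOpenPartialHomeomorph.isOpen_inter_preimage hv, ⟨hx, hxu⟩, ⟨hy, hyv⟩,
      (huv.preimage e).mono inter_subset_right inter_subset_right⟩
  · exact separated_by_continuous (FiberBundle.continuous_proj F V) h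

/-- The total space of a fibre bundle over a σ-compact manifold with second countable fibre and
model is second countable. -/
theorem FiberBundle.secondCountableTopology_totalSpace {B F H : Type*} [TopologicalSpace B]
    [TopologicalSpace F] [TopologicalSpace H] [ChartedSpace H B]
    (V : B → Type*) [TopologicalSpace (TotalSpace F V)] [∀ b, TopologicalSpace (V b)]
    [FiberBundle F V] [SecondCountableTopology H] [SecondCountableTopology F]
    [SigmaCompactSpace B] : SecondCountableTopology (TotalSpace F V) := by
  have : SecondCountableTopology B := ChartedSpace.secondCountable_of_sigmaCompact H B
  obtain ⟨s, hsc, hs⟩ := countable_cover_nhds (X := B)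
    (U := fun b => (trivializationAt F V b).baseSet)
    fun b => (trivializationAt F V b).open_baseSet.mem_nhds (mem_baseSet_trivializationAt F V b)
  have : SecondCountableTopology (ModelProd H F) :=
    inferInstanceAs (SecondCountableTopology (H × F))
  have : ∀ b : s, SecondCountableTopology (trivializationAt F V b.1).source := fun b =>
    (trivializationAt F V b).toOpenPartialHomeomorph.secondCountableTopology_source
  have hc : Countable s := hsc
  refine TopologicalSpace.secondCountableTopology_of_countable_cover
    (U := fun b : s => (trivializationAt F V b.1).source) 
    (fun b => (trivializationAt F V b.1).open_source) ?_
  · refine iUnion_eq_univ_iff.2 fun x => ?_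
    obtain ⟨b, hb, hx⟩ := mem_iUnion₂.1 (hs.symm ▸ mem_univ x.proj :
      x.proj ∈ ⋃ b ∈ s, (trivializationAt F V b).baseSet)
    exact ⟨⟨b, hb⟩, (trivializationAt F V b).mem_source.2 hx⟩

/-! ### Calculus on manifolds -/

section Manifold

variable {F : Type*} [NormedAddCommGroup F] [NormedSpace ℝ F]
  {H : Type*} [TopologicalSpace H] {I : ModelWithCorners ℝ F H}
  {M : Type*} [TopologicalSpace M] [ChartedSpace H M]

/-- A finite family of smooth vector bundle sections subject to a fibrewise convex condition can be
glued from local families by a partition of unity. -/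
theorem exists_contMDiff_sections_forall_mem_convex_of_local [FiniteDimensional ℝ F]
    [IsManifold I ∞ M] [SigmaCompactSpace M] [T2Space M] {ι : Type*}
    {F' : Type*} [NormedAddCommGroup F'] [NormedSpace ℝ F']
    (V : M → Type*) [∀ x, AddCommGroup (V x)] [∀ x, TopologicalSpace (V x)] [∀ x, Module ℝ (V x)]
    [TopologicalSpace (TotalSpace F' V)] [FiberBundle F' V] [VectorBundle ℝ F' V]
    (t : ∀ x, Set (ι → V x)) (ht : ∀ x, Convex ℝ (t x))
    (Hloc : ∀ x₀ : M, ∃ U : Set M, IsOpen U ∧ x₀ ∈ U ∧ ∃ s : ι → (x : M) → V x,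
      (∀ a, ContMDiffOn I (I.prod 𝓘(ℝ, F')) ∞ (fun x => TotalSpace.mk' F' x (s a x)) U) ∧
        ∀ y ∈ U, (fun a => s a y) ∈ t y) :
    ∃ s : ι → (x : M) → V x,
      (∀ a, ContMDiff I (I.prod 𝓘(ℝ, F')) ∞ (fun x => TotalSpace.mk' F' x (s a x))) ∧
        ∀ x, (fun a => s a x) ∈ t x := by
  choose U hUo hxU s hs hst using Hloc
  obtain ⟨ρ, hρ⟩ := SmoothPartitionOfUnity.exists_isSubordinate I isClosed_univ U hUo
    fun x _ => mem_iUnion.2 ⟨x, hxU x⟩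
  refine ⟨fun a x => ∑ᶠ j, ρ j x • s j a x, fun a => ?_, fun x => ?_⟩
  · refine ContMDiff.finsum_section_of_locallyFinite (ρ.locallyFinite.subset fun i x hx => ?_)
      fun j => ?_
    · exact left_ne_zero_of_smul hx
    · exact ContMDiffOn.smul_section_of_tsupport (ρ j).contMDiff.contMDiffOn (hUo j) (hρ j)
        (hs j a)
  · have hfin : (Function.support fun j => ρ j x).Finite := ρ.locallyFinite.point_finite x
    -- The condition `t x` couples all indices `a`, so the whole tuple has to be exhibited as one
    -- convex combination. The sums are taken over the support of `ρ · x`, which is finite and does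
    -- not depend on `a`.
    have hsum : (fun a => ∑ᶠ j, ρ j x • s j a x) = ∑ᶠ j, ρ j x • fun a => s j a x := by
      rw [finsum_eq_sum_of_support_subset (s := hfin.toFinset)]
      · ext a
        rw [finsum_eq_sum_of_support_subset (s := hfin.toFinset)]
        · simp
        · intro j hj
          simpa using left_ne_zero_of_smul hj
      · intro j hj
        simpa using left_ne_zero_of_smul hj
    change (fun a => ∑ᶠ j, ρ j x • s j a x) ∈ t x
    rw [hsum]
    refine (ht x).finsum_mem (fun j => ρ.nonneg j x) (ρ.sum_eq_one (mem_univ x)) fun j hj => ?_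
    exact hst j x (hρ j (subset_closure hj))

/-- A function with vanishing derivative on a connected manifold without boundary is constant. -/
theorem eq_of_mfderiv_eq_zero [IsManifold I 1 M] [I.Boundaryless] [PreconnectedSpace M]
    {f : M → ℝ} (hf : MDifferentiable I 𝓘(ℝ, ℝ) f) (h : ∀ x, mfderiv I 𝓘(ℝ, ℝ) f x = 0)
    (x y : M) : f x = f y := by
  have hloc : IsLocallyConstant f := by
    rw [IsLocallyConstant.iff_eventually_eq]
    intro x
    obtain ⟨ε, hε, hball⟩ := Metric.mem_nhds_iff.1 (extChartAt_target_mem_nhds (I := I) x)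
    have hd : ∀ y ∈ Metric.ball (extChartAt I x x) ε,
        HasFDerivAt (f ∘ (extChartAt I x).symm) (0 : F →L[ℝ] ℝ) y := by
      intro y hy
      have h1 : MDifferentiableAt 𝓘(ℝ, F) I (extChartAt I x).symm y := by
        have := mdifferentiableWithinAt_extChartAt_symm (hball hy)
        rwa [I.range_eq_univ, mdifferentiableWithinAt_univ] at this
      have h2 := (hf ((extChartAt I x).symm y)).hasMFDerivAt.comp y h1.hasMFDerivAt
      rw [h] at h2
      have h3 := h2.hasFDerivAt
      convert! h3 using 1
    have hc : ∀ y ∈ Metric.ball (extChartAt I x x) ε,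
        (f ∘ (extChartAt I x).symm) y = (f ∘ (extChartAt I x).symm) (extChartAt I x x) := by
      intro y hy
      refine (convex_ball _ ε).is_const_of_fderivWithin_eq_zero (𝕜 := ℝ)
        (fun z hz => (hd z hz).differentiableAt.differentiableWithinAt) (fun z hz => ?_) hy
        (Metric.mem_ball_self hε)
      rw [fderivWithin_of_isOpen Metric.isOpen_ball hz, (hd z hz).fderiv]
    have hmem := (continuousAt_extChartAt (I := I) x).preimage_mem_nhds (Metric.ball_mem_nhds _ hε)
    filter_upwards [hmem, extChartAt_source_mem_nhds (I := I) x] with y hy hys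
    have := hc _ hy
    rwa [Function.comp_apply, Function.comp_apply, (extChartAt I x).left_inv hys,
      extChartAt_to_inv] at this
  exact hloc.apply_eq_of_preconnectedSpace x y

end Manifold

/-! ### Exterior derivatives of 1-forms computed in an arbitrary chart. -/

namespace KSymplectic

section ExteriorDerivative

variable {F : Type*} [NormedAddCommGroup F] [NormedSpace ℝ F]
  {H : Type*} [TopologicalSpace H] {I : ModelWithCorners ℝ F H}
  {M : Type*} [TopologicalSpace M] [ChartedSpace H M]

variable (I) in
/-- The derivative at `m` of the preferred chart at `x`. -/
noncomputable def extChartDeriv (x m : M) : TangentSpace I m →L[ℝ] F :=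
  mfderiv I 𝓘(ℝ, F) (extChartAt I x) m

/-- The tangent space at `x` is the model space, identified through the preferred chart at `x`;
tangent vectors at the centre of a chart are therefore their own coordinates. -/
theorem extChartDeriv_self [IsManifold I 1 M] (x : M) (X : TangentSpace I x) :
    extChartDeriv I x x X = X :=
  DFunLike.congr_fun (mfderiv_extChartAt_self (I := I) (x := x)) X

variable [I.Boundaryless]

theorem mdifferentiableAt_extChartAt_symm [IsManifold I 1 M] {x : M} {y : F}
    (hy : y ∈ (extChartAt I x).target) :
    MDifferentiableAt 𝓘(ℝ, F) I (extChartAt I x).symm y := by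
  have := mdifferentiableWithinAt_extChartAt_symm hy
  rwa [I.range_eq_univ, mdifferentiableWithinAt_univ] at this

theorem chartSymmDeriv_extChartDeriv [IsManifold I 1 M] {x : M} {y : F}
    (hy : y ∈ (extChartAt I x).target) (X : TangentSpace I ((extChartAt I x).symm y)) :
    chartSymmDeriv I x y (extChartDeriv I x ((extChartAt I x).symm y) X) = X := by
  have := mfderivWithin_extChartAt_symm_comp_mfderiv_extChartAt hy
  rw [I.range_eq_univ, mfderivWithin_univ] at this
  exact DFunLike.congr_fun this X

theorem extChartDeriv_chartSymmDeriv [IsManifold I 1 M] {x : M} {y : F}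
    (hy : y ∈ (extChartAt I x).target) (u : F) :
    extChartDeriv I x ((extChartAt I x).symm y) (chartSymmDeriv I x y u) = u := by
  have := mfderiv_extChartAt_comp_mfderivWithin_extChartAt_symm hy
  rw [I.range_eq_univ, mfderivWithin_univ] at this
  exact DFunLike.congr_fun this u

theorem chartForm_extChartDeriv [IsManifold I 1 M]
    (α : (x : M) → TangentSpace I x →L[ℝ] ℝ) {x m : M} (hm : m ∈ (extChartAt I x).source)
    (X : TangentSpace I m) :
    chartForm I α x (extChartAt I x m) (extChartDeriv I x m X) = α m X := by
  obtain ⟨y, hy, rfl⟩ : ∃ y ∈ (extChartAt I x).target, (extChartAt I x).symm y = m :=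
    ⟨_, (extChartAt I x).map_source hm, (extChartAt I x).left_inv hm⟩
  rw [(extChartAt I x).right_inv hy, chartForm, ContinuousLinearMap.comp_apply,
    chartSymmDeriv_extChartDeriv hy]

/-- The transition from the chart at `w` to the chart at `x`. -/
theorem contDiffAt_extChartAt_comp_symm [IsManifold I ∞ M] {x w : M}
    (hw : w ∈ (extChartAt I x).source) :
    ContDiffAt ℝ ∞ (extChartAt I x ∘ (extChartAt I w).symm) (extChartAt I w w) := by
  have := contDiffWithinAt_ext_coord_change (I := I) (n := ∞) x w
    (y := extChartAt I w w) (by simpa [PartialEquiv.trans_source] using hw)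
  rwa [I.range_eq_univ, contDiffWithinAt_univ] at this

/-- By the chain rule two local expressions of `α` differ by pullback along the transition map, on
the overlap of the charts, which is a neighbourhood. -/
theorem chartForm_eventuallyEq [IsManifold I ∞ M] (α : (x : M) → TangentSpace I x →L[ℝ] ℝ)
    {x w : M} (hw : w ∈ (extChartAt I x).source) :
    chartForm I α w =ᶠ[𝓝 (extChartAt I w w)] fun y =>
      (chartForm I α x ((extChartAt I x ∘ (extChartAt I w).symm) y)).comp
        (fderiv ℝ (extChartAt I x ∘ (extChartAt I w).symm) y) := by
  have : IsManifold I 1 M := .of_le (n := ∞) (by norm_num)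
  have h1 : (extChartAt I w).symm ⁻¹' (extChartAt I x).source ∈ 𝓝 (extChartAt I w w) :=
    (continuousAt_extChartAt_symm w).preimage_mem_nhds
      (by simpa using (isOpen_extChartAt_source (I := I) x).mem_nhds hw)
  filter_upwards [h1, extChartAt_target_mem_nhds (I := I) w] with y hy hyt
  have hd : ∀ u, fderiv ℝ (extChartAt I x ∘ (extChartAt I w).symm) y u =
      extChartDeriv I x ((extChartAt I w).symm y) (chartSymmDeriv I w y u) := by
    have h2 := (mdifferentiableAt_extChartAt (I := I) (x := x)
      (y := (extChartAt I w).symm y) (by simpa using hy)).hasMFDerivAt.comp y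
      (mdifferentiableAt_extChartAt_symm hyt).hasMFDerivAt
    have h3 := h2.mfderiv
    rw [mfderiv_eq_fderiv] at h3
    exact fun u => DFunLike.congr_fun h3 u
  ext u
  rw [ContinuousLinearMap.comp_apply, hd, Function.comp_apply, chartForm_extChartDeriv α hy]
  rfl

theorem differentiableAt_ofSubsingleton {a : F → F →L[ℝ] ℝ} {y : F}
    (ha : DifferentiableAt ℝ a y) :
    DifferentiableAt ℝ (fun y : F => ContinuousAlternatingMap.ofSubsingleton ℝ F ℝ
      (0 : Fin 1) (a y)) y :=
  (ContinuousAlternatingMap.ofSubsingletonLIE (𝕜 := ℝ) (E := F) (F := ℝ)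
    (0 : Fin 1)).differentiableAt.comp y ha

/-- The exterior derivative of a 1-form can be computed in any chart. -/
theorem extDer_eq_of_mem_source [IsManifold I ∞ M] {α : (x : M) → TangentSpace I x →L[ℝ] ℝ}
    {x w : M} (hw : w ∈ (extChartAt I x).source)
    (hα : DifferentiableAt ℝ (chartForm I α x) (extChartAt I x w)) :
    extDer I α w =
      (extDeriv (fun y : F => ContinuousAlternatingMap.ofSubsingleton ℝ F ℝ (0 : Fin 1)
        (chartForm I α x y)) (extChartAt I x w)).compContinuousLinearMap
          (extChartDeriv I x w) := by
  have : IsManifold I 1 M := .of_le (n := ∞) (by norm_num)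
  have hev := chartForm_eventuallyEq α hw
  have hpull : (fun y : F => ContinuousAlternatingMap.ofSubsingleton ℝ F ℝ (0 : Fin 1)
      (chartForm I α w y)) =ᶠ[𝓝 (extChartAt I w w)] fun y =>
      (ContinuousAlternatingMap.ofSubsingleton ℝ F ℝ (0 : Fin 1) (chartForm I α x
        ((extChartAt I x ∘ (extChartAt I w).symm) y))).compContinuousLinearMap
          (fderiv ℝ (extChartAt I x ∘ (extChartAt I w).symm) y) := by
    filter_upwards [hev] with y hy
    rw [hy]
    rfl
  have hw' : (extChartAt I x ∘ (extChartAt I w).symm) (extChartAt I w w) = extChartAt I x w := by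
    simp
  have hα' : DifferentiableAt ℝ (fun y : F => ContinuousAlternatingMap.ofSubsingleton ℝ F ℝ
      (0 : Fin 1) (chartForm I α x y))
      ((extChartAt I x ∘ (extChartAt I w).symm) (extChartAt I w w)) := by
    rw [hw']
    exact differentiableAt_ofSubsingleton hα
  -- Naturality of `d` under the transition map is the whole content; the remaining equalities
  -- identify the derivatives involved.
  have key := extDeriv_pullback hα' (contDiffAt_extChartAt_comp_symm hw)
    (by rw [minSmoothness_of_isRCLikeNormedField]; exact ENat.LEInfty.out)
  have hd : fderiv ℝ (extChartAt I x ∘ (extChartAt I w).symm) (extChartAt I w w) =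
      extChartDeriv I x w := by
    have h1 : MDifferentiableAt I 𝓘(ℝ, F) (extChartAt I x) w :=
      mdifferentiableAt_extChartAt (by simpa using hw)
    have h2 := h1.mfderiv
    rw [I.range_eq_univ, fderivWithin_univ] at h2
    exact h2.symm
  have hc : chartDeriv I w = ContinuousLinearMap.id ℝ _ := mfderiv_extChartAt_self
  rw [extDer, hpull.extDeriv_eq, key, hw', hd, hc]
  rfl

theorem extDeriv_ofSubsingleton_apply {a : F → F →L[ℝ] ℝ} {y : F} (ha : DifferentiableAt ℝ a y)
    (X Z : F) :
    extDeriv (fun y : F => ContinuousAlternatingMap.ofSubsingleton ℝ F ℝ (0 : Fin 1) (a y)) y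
      ![X, Z] = fderiv ℝ a y X Z - fderiv ℝ a y Z X := by
  have ha' : DifferentiableAt ℝ (fun y : F => ContinuousAlternatingMap.ofSubsingleton ℝ F ℝ
      (0 : Fin 1) (a y)) y :=
    differentiableAt_ofSubsingleton ha
  have h : ∀ v u : F, fderiv ℝ (fun y => a y v) y u = fderiv ℝ a y u v := fun v u => by
    rw [fderiv_clm_apply ha (differentiableAt_const v)]
    simp
  rw [extDeriv_apply ha', Fin.sum_univ_two]
  simp [Fin.removeNth, h, sub_eq_add_neg]

/-- `extDer` uses a different chart at every point. Fixing one chart, with `w` not necessarily its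
centre, is what later lets smooth dependence on the point be read off. -/
theorem extDer_apply_of_mem_source [IsManifold I ∞ M] {α : (x : M) → TangentSpace I x →L[ℝ] ℝ}
    {x w : M} (hw : w ∈ (extChartAt I x).source)
    (hα : DifferentiableAt ℝ (chartForm I α x) (extChartAt I x w)) (X Z : TangentSpace I w) :
    extDer I α w ![X, Z] =
      fderiv ℝ (chartForm I α x) (extChartAt I x w) (extChartDeriv I x w X)
          (extChartDeriv I x w Z) -
        fderiv ℝ (chartForm I α x) (extChartAt I x w) (extChartDeriv I x w Z)
          (extChartDeriv I x w X) := by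
  rw [extDer_eq_of_mem_source hw hα, ← extDeriv_ofSubsingleton_apply hα,
    ContinuousAlternatingMap.compContinuousLinearMap_apply]
  congr 1
  ext i
  fin_cases i <;> rfl

end ExteriorDerivative

end KSymplectic

/-! ### Chart expressions, and the induced charts of `T¹ₖQ`. -/

namespace KSymplectic

section ChartExpression

variable {F : Type*} [NormedAddCommGroup F] [NormedSpace ℝ F]
  {H : Type*} [TopologicalSpace H] {I : ModelWithCorners ℝ F H}
  {M : Type*} [TopologicalSpace M] [ChartedSpace H M]

variable (I) in
/-- The expression of a function in the preferred chart at `x`. -/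
noncomputable def chartFun (f : M → ℝ) (x : M) (y : F) : ℝ := f ((extChartAt I x).symm y)

theorem chartFun_extChartAt (f : M → ℝ) {x m : M} (hm : m ∈ (extChartAt I x).source) :
    chartFun I f x (extChartAt I x m) = f m := by
  rw [chartFun, (extChartAt I x).left_inv hm]

variable [I.Boundaryless]

theorem contDiffAt_chartFun [IsManifold I ∞ M] {f : M → ℝ} (hf : ContMDiff I 𝓘(ℝ, ℝ) ∞ f) {x : M}
    {y : F} (hy : y ∈ (extChartAt I x).target) : ContDiffAt ℝ ∞ (chartFun I f x) y := by
  have h := (contMDiffOn_extChartAt_symm (I := I) (n := ∞) x).contMDiffAt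
    ((isOpen_extChartAt_target x).mem_nhds hy)
  exact (hf.contMDiffAt.comp y h).contDiffAt

theorem fderiv_chartFun [IsManifold I 1 M] {f : M → ℝ} {x : M} {y : F}
    (hy : y ∈ (extChartAt I x).target)
    (hf : MDifferentiableAt I 𝓘(ℝ, ℝ) f ((extChartAt I x).symm y)) (u : F) :
    fderiv ℝ (chartFun I f x) y u =
      mfderiv I 𝓘(ℝ, ℝ) f ((extChartAt I x).symm y) (chartSymmDeriv I x y u) := by
  have h2 := (hf.hasMFDerivAt.comp y (mdifferentiableAt_extChartAt_symm hy).hasMFDerivAt).mfderiv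
  rw [mfderiv_eq_fderiv] at h2
  exact DFunLike.congr_fun h2 u

theorem mfderiv_eq_fderiv_chartFun [IsManifold I 1 M] {f : M → ℝ} {x m : M}
    (hm : m ∈ (extChartAt I x).source) (hf : MDifferentiableAt I 𝓘(ℝ, ℝ) f m)
    (X : TangentSpace I m) :
    mfderiv I 𝓘(ℝ, ℝ) f m X =
      fderiv ℝ (chartFun I f x) (extChartAt I x m) (extChartDeriv I x m X) := by
  obtain ⟨y, hy, rfl⟩ : ∃ y ∈ (extChartAt I x).target, (extChartAt I x).symm y = m :=
    ⟨_, (extChartAt I x).map_source hm, (extChartAt I x).left_inv hm⟩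
  rw [(extChartAt I x).right_inv hy, fderiv_chartFun hy hf, chartSymmDeriv_extChartDeriv hy]

end ChartExpression

section VelocityChart

variable {k : ℕ} {E : Type*} [NormedAddCommGroup E] [NormedSpace ℝ E]
variable {Q : Type*} [TopologicalSpace Q] [ChartedSpace E Q]

theorem extChartDeriv_single (q m : Q) (A : Fin k) (v : TangentSpace 𝓘(ℝ, E) m) :
    (fun B => extChartDeriv 𝓘(ℝ, E) q m ((Pi.single A v : Fin k → E) B)) =
      (Pi.single A (extChartDeriv 𝓘(ℝ, E) q m v) : Fin k → E) := by
  have h : ∀ (T : E →L[ℝ] E) (v : E),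
      (fun B => T ((Pi.single A v : Fin k → E) B)) = Pi.single A (T v) := fun T v => by
    funext B
    by_cases hB : B = A
    · subst hB
      rw [Pi.single_eq_same, Pi.single_eq_same]
    · rw [Pi.single_eq_of_ne hB, Pi.single_eq_of_ne hB, map_zero]
  exact h _ v

variable [IsManifold 𝓘(ℝ, E) ∞ Q]

/-- The coordinate changes of `velocityCore` are those of `TQ` in each slot, and the latter are
derivatives of charts. -/
theorem trivializationAt_velocitySpace_apply {q : Q} {z : VelocityBundle k E Q}
    (hz : z.1 ∈ (chartAt E q).source) :
    trivializationAt (Fin k → E) (VelocitySpace k E) q z =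
      (z.1, fun A => extChartDeriv 𝓘(ℝ, E) q z.1 (z.2 A)) := by
  have h : ∀ v : E, (tangentBundleCore 𝓘(ℝ, E) Q).coordChange (achart E z.1) (achart E q) z.1 v =
      extChartDeriv 𝓘(ℝ, E) q z.1 v := fun v => by
    have h1 := TangentBundle.continuousLinearMapAt_trivializationAt_eq_core (I := 𝓘(ℝ, E)) hz
    rw [TangentBundle.continuousLinearMapAt_trivializationAt hz] at h1
    exact (DFunLike.congr_fun h1 v).symm
  refine Prod.ext rfl (funext fun A => ?_)
  exact h (z.2 A)

theorem mem_velocityChart_source {w z : VelocityBundle k E Q} :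
    z ∈ (extChartAt (velocityModel k E) w).source ↔ z.1 ∈ (extChartAt 𝓘(ℝ, E) w.1).source := by
  rw [FiberBundle.extChartAt, extChartAt_source]
  simp only [PartialEquiv.trans_source, mem_inter_iff, mem_preimage, PartialEquiv.prod_source,
    extChartAt_source, PartialEquiv.refl_source, mem_prod, mem_univ, and_true]
  constructor
  · rintro ⟨h1, h2⟩
    exact ((trivializationAt (Fin k → E) (VelocitySpace k E) w.1).mem_source).1 h1
  · intro h
    have h1 : z ∈ (trivializationAt (Fin k → E) (VelocitySpace k E) w.1).source :=
      ((trivializationAt (Fin k → E) (VelocitySpace k E) w.1).mem_source).2 h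
    refine ⟨h1, ?_⟩
    exact h

theorem mem_velocityChart_target {w : VelocityBundle k E Q} {p : E × (Fin k → E)} :
    p ∈ (extChartAt (velocityModel k E) w).target ↔ p.1 ∈ (extChartAt 𝓘(ℝ, E) w.1).target := by
  rw [FiberBundle.extChartAt_target]
  simp only [mem_prod, mem_univ, and_true, mem_inter_iff, mem_preimage, and_iff_left_iff_imp]
  intro h
  have := (extChartAt 𝓘(ℝ, E) w.1).map_target h
  rw [extChartAt_source] at this
  exact this

theorem velocityChart_apply {w z : VelocityBundle k E Q}
    (hz : z.1 ∈ (extChartAt 𝓘(ℝ, E) w.1).source) :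
    extChartAt (velocityModel k E) w z =
      (extChartAt 𝓘(ℝ, E) w.1 z.1, fun A => extChartDeriv 𝓘(ℝ, E) w.1 z.1 (z.2 A)) := by
  rw [extChartAt_source] at hz
  have h := trivializationAt_velocitySpace_apply (k := k) hz
  rw [FiberBundle.extChartAt]
  change (extChartAt 𝓘(ℝ, E) w.1
    (trivializationAt (Fin k → E) (VelocitySpace k E) w.1 z).1,
    (trivializationAt (Fin k → E) (VelocitySpace k E) w.1 z).2) = _
  rw [h]

theorem velocityChart_symm_apply {w : VelocityBundle k E Q} {p : E × (Fin k → E)}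
    (hp : p.1 ∈ (extChartAt 𝓘(ℝ, E) w.1).target) :
    (extChartAt (velocityModel k E) w).symm p =
      ⟨(extChartAt 𝓘(ℝ, E) w.1).symm p.1, fun A => chartSymmDeriv 𝓘(ℝ, E) w.1 p.1 (p.2 A)⟩ := by
  set z : VelocityBundle k E Q :=
    ⟨(extChartAt 𝓘(ℝ, E) w.1).symm p.1, fun A => chartSymmDeriv 𝓘(ℝ, E) w.1 p.1 (p.2 A)⟩
  have hz : z.1 ∈ (extChartAt 𝓘(ℝ, E) w.1).source := (extChartAt 𝓘(ℝ, E) w.1).map_target hp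
  have h : extChartAt (velocityModel k E) w z = p := by
    rw [velocityChart_apply hz]
    refine Prod.ext ((extChartAt 𝓘(ℝ, E) w.1).right_inv hp) (funext fun A => ?_)
    exact extChartDeriv_chartSymmDeriv hp _
  rw [← h, (extChartAt (velocityModel k E) w).left_inv (mem_velocityChart_source.2 hz)]

theorem velocityChart_self (w : VelocityBundle k E Q) :
    extChartAt (velocityModel k E) w w = (extChartAt 𝓘(ℝ, E) w.1 w.1, w.2) := by
  rw [velocityChart_apply (mem_extChartAt_source w.1)]
  exact Prod.ext rfl (funext fun A => extChartDeriv_self w.1 (w.2 A))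

theorem contMDiff_fibreIncl (q : Q) :
    ContMDiff 𝓘(ℝ, Fin k → E) (velocityModel k E) ∞ (fibreIncl (k := k) (E := E) q) := by
  intro v
  rw [Bundle.contMDiffAt_totalSpace]
  refine ⟨contMDiffAt_const, ?_⟩
  have h : (fun v' : Fin k → E => (trivializationAt (Fin k → E) (VelocitySpace k E) q
      (fibreIncl q v')).2) = fun v' : Fin k → E => v' := by
    funext v'
    have := trivializationAt_velocitySpace_apply (q := q) (z := fibreIncl q v')
      (mem_chart_source E q)
    rw [this]
    exact funext fun A => extChartDeriv_self q (v' A)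
  change ContMDiffAt _ _ _ (fun v' : Fin k → E => (trivializationAt (Fin k → E)
    (VelocitySpace k E) q (fibreIncl q v')).2) v
  rw [h]
  exact contMDiffAt_id

/-- Restricted to a fibre, the chart is constant in the base component and linear in the velocities,
so it is its own derivative there. -/
theorem extChartDeriv_verticalLift {w m : VelocityBundle k E Q}
    (hm : m ∈ (extChartAt (velocityModel k E) w).source) (u : Fin k → E) :
    extChartDeriv (velocityModel k E) w m (verticalLift m u) =
      (0, fun A => extChartDeriv 𝓘(ℝ, E) w.1 m.1 (u A)) := by
  have hmQ := mem_velocityChart_source.1 hm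
  have hi : MDifferentiableAt 𝓘(ℝ, Fin k → E) (velocityModel k E)
      (fibreIncl (k := k) (E := E) m.1) m.2 :=
    (contMDiff_fibreIncl m.1).mdifferentiable (by simp) _
  have he : MDifferentiableAt (velocityModel k E) 𝓘(ℝ, E × (Fin k → E))
      (extChartAt (velocityModel k E) w) (fibreIncl (k := k) (E := E) m.1 m.2) :=
    mdifferentiableAt_extChartAt (I := velocityModel k E) (x := w) (y := m)
      (by rwa [extChartAt_source] at hm)
  have h1 := (HasMFDerivAt.comp (I := 𝓘(ℝ, Fin k → E)) (M := Fin k → E) m.2 he.hasMFDerivAt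
    hi.hasMFDerivAt)
  let T : (Fin k → E) →L[ℝ] (Fin k → E) :=
    ContinuousLinearMap.piMap (fun _ => (extChartDeriv 𝓘(ℝ, E) w.1 m.1 : E →L[ℝ] E))
  have h2 : (extChartAt (velocityModel k E) w) ∘ (fibreIncl m.1) =
      fun v : Fin k → E => (extChartAt 𝓘(ℝ, E) w.1 m.1, T v) := by
    funext v
    exact velocityChart_apply (z := fibreIncl m.1 v) hmQ
  have h3 : HasFDerivAt (fun v : Fin k → E => (extChartAt 𝓘(ℝ, E) w.1 m.1, T v))
      ((0 : (Fin k → E) →L[ℝ] E).prod T) m.2 :=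
    (hasFDerivAt_const _ _).prodMk T.hasFDerivAt
  rw [h2] at h1
  exact DFunLike.congr_fun (hasMFDerivAt_unique h1 h3.hasMFDerivAt) u

theorem extChartDeriv_projDeriv {w m : VelocityBundle k E Q}
    (hm : m ∈ (extChartAt (velocityModel k E) w).source)
    (X : TangentSpace (velocityModel k E) m) :
    extChartDeriv 𝓘(ℝ, E) w.1 m.1 (projDeriv m X) =
      (extChartDeriv (velocityModel k E) w m X).1 := by
  have hmQ := mem_velocityChart_source.1 hm
  have hpi : MDifferentiableAt (velocityModel k E) 𝓘(ℝ, E)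
      (fun z : VelocityBundle k E Q => z.1) m :=
    mdifferentiableAt_proj (VelocitySpace k E)
  have h1 := ((mdifferentiableAt_extChartAt (I := 𝓘(ℝ, E)) (x := w.1) (y := m.1)
    (by rwa [extChartAt_source] at hmQ)).hasMFDerivAt.comp m hpi.hasMFDerivAt).mfderiv
  have h2 := ((ContinuousLinearMap.fst ℝ E (Fin k → E)).hasMFDerivAt.comp m
    (mdifferentiableAt_extChartAt (I := velocityModel k E) (x := w) (y := m)
    (by rwa [extChartAt_source] at hm)).hasMFDerivAt).mfderiv
  have h3 : (extChartAt 𝓘(ℝ, E) w.1) ∘ (fun z : VelocityBundle k E Q => z.1) =ᶠ[𝓝 m]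
      (ContinuousLinearMap.fst ℝ E (Fin k → E)) ∘ (extChartAt (velocityModel k E) w) := by
    filter_upwards [(isOpen_extChartAt_source (I := velocityModel k E) w).mem_nhds hm] with z hz
    rw [Function.comp_apply, Function.comp_apply,
      velocityChart_apply (mem_velocityChart_source.1 hz)]
    rfl
  rw [h3.mfderiv_eq, h2] at h1
  exact (DFunLike.congr_fun h1 X).symm

variable (k E) in
/-- The coordinate expression of the canonical endomorphism `S^A`. -/
noncomputable def vertEndo (A : Fin k) : E × (Fin k → E) →L[ℝ] E × (Fin k → E) :=
  (ContinuousLinearMap.inr ℝ E (Fin k → E)).comp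
    ((ContinuousLinearMap.single ℝ (fun _ : Fin k => E) A).comp
      (ContinuousLinearMap.fst ℝ E (Fin k → E)))

theorem vertEndo_apply (A : Fin k) (p : E × (Fin k → E)) :
    vertEndo k E A p = (0, Pi.single A p.1) := rfl

/-- `S^A` has constant coefficients in induced charts, so differentiating `dL ∘ S^A` produces second
derivatives of `L` and nothing else. -/
theorem extChartDeriv_canonicalEndo {w m : VelocityBundle k E Q}
    (hm : m ∈ (extChartAt (velocityModel k E) w).source) (A : Fin k)
    (X : TangentSpace (velocityModel k E) m) :
    extChartDeriv (velocityModel k E) w m (canonicalEndo A m X) =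
      vertEndo k E A (extChartDeriv (velocityModel k E) w m X) := by
  rw [vertEndo_apply, ← extChartDeriv_projDeriv hm]
  refine (extChartDeriv_verticalLift hm (Pi.single A (projDeriv m X))).trans ?_
  exact Prod.ext rfl (extChartDeriv_single w.1 m.1 A (projDeriv m X))

theorem extChartDeriv_liouville {w m : VelocityBundle k E Q}
    (hm : m ∈ (extChartAt (velocityModel k E) w).source) :
    extChartDeriv (velocityModel k E) w m (liouville m) =
      (0, (extChartAt (velocityModel k E) w m).2) := by
  rw [velocityChart_apply (mem_velocityChart_source.1 hm)]
  exact extChartDeriv_verticalLift hm m.2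

end VelocityChart

end KSymplectic

/-! ### The forms `ω_L^A` and the energy in coordinates. -/

theorem ContDiffAt.differentiableAt_fderiv_infty {F G : Type*} [NormedAddCommGroup F]
    [NormedSpace ℝ F] [NormedAddCommGroup G] [NormedSpace ℝ G] {f : F → G} {p : F}
    (hf : ContDiffAt ℝ ∞ f p) : DifferentiableAt ℝ (fderiv ℝ f) p :=
  (hf.fderiv_right (m := ∞) (by simp)).differentiableAt (by simp)

theorem fderiv_fderiv_comp_apply {F G : Type*} [NormedAddCommGroup F] [NormedSpace ℝ F]
    [NormedAddCommGroup G] [NormedSpace ℝ G] {f : F → ℝ} {p : F}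
    (hf : ContDiffAt ℝ ∞ f p) (C : G →L[ℝ] F) (X : F) (Y : G) :
    fderiv ℝ (fun p => (fderiv ℝ f p).comp C) p X Y = fderiv ℝ (fderiv ℝ f) p X (C Y) := by
  have h := ((ContinuousLinearMap.compL ℝ G F ℝ).flip C).hasFDerivAt.comp p
    hf.differentiableAt_fderiv_infty.hasFDerivAt
  have h' : HasFDerivAt (fun p => (fderiv ℝ f p).comp C)
    (((ContinuousLinearMap.compL ℝ G F ℝ).flip C).comp (fderiv ℝ (fderiv ℝ f) p)) p := h
  rw [h'.fderiv]
  rfl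

namespace KSymplectic

variable {k : ℕ} {E : Type*} [NormedAddCommGroup E] [NormedSpace ℝ E]
variable {Q : Type*} [TopologicalSpace Q] [ChartedSpace E Q] [IsManifold 𝓘(ℝ, E) ∞ Q]

section Omega

variable {L : VelocityBundle k E Q → ℝ}

theorem differential_apply {w m : VelocityBundle k E Q}
    (hm : m ∈ (extChartAt (velocityModel k E) w).source)
    (hL : MDifferentiableAt (velocityModel k E) 𝓘(ℝ, ℝ) L m)
    (X : TangentSpace (velocityModel k E) m) :
    differential L m X = fderiv ℝ (chartFun (velocityModel k E) L w)
      (extChartAt (velocityModel k E) w m) (extChartDeriv (velocityModel k E) w m X) :=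
  mfderiv_eq_fderiv_chartFun hm hL X

theorem chartForm_thetaL (hL : ContMDiff (velocityModel k E) 𝓘(ℝ, ℝ) ∞ L)
    {w : VelocityBundle k E Q} {p : E × (Fin k → E)}
    (hp : p ∈ (extChartAt (velocityModel k E) w).target) (A : Fin k) :
    chartForm (velocityModel k E) (thetaL L A) w p =
      (fderiv ℝ (chartFun (velocityModel k E) L w) p).comp (vertEndo k E A) := by
  have hm := (extChartAt (velocityModel k E) w).map_target hp
  refine ContinuousLinearMap.ext fun u => ?_
  rw [ContinuousLinearMap.comp_apply]
  change differential L ((extChartAt (velocityModel k E) w).symm p)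
    (canonicalEndo A _ (chartSymmDeriv (velocityModel k E) w p u)) = _
  rw [differential_apply hm (hL.mdifferentiable (by simp) _), extChartDeriv_canonicalEndo hm,
    extChartDeriv_chartSymmDeriv hp, (extChartAt (velocityModel k E) w).right_inv hp]

theorem chartForm_thetaL_eventuallyEq (hL : ContMDiff (velocityModel k E) 𝓘(ℝ, ℝ) ∞ L)
    {w : VelocityBundle k E Q} {p : E × (Fin k → E)}
    (hp : p ∈ (extChartAt (velocityModel k E) w).target) (A : Fin k) :
    chartForm (velocityModel k E) (thetaL L A) w =ᶠ[𝓝 p] fun p =>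
      (fderiv ℝ (chartFun (velocityModel k E) L w) p).comp (vertEndo k E A) :=
  eventually_of_mem ((isOpen_extChartAt_target w).mem_nhds hp) fun _ hy => chartForm_thetaL hL hy A

/-- The form `ω_L^A` in the coordinates of an arbitrary preferred chart. -/
theorem omegaL_apply (hL : ContMDiff (velocityModel k E) 𝓘(ℝ, ℝ) ∞ L)
    {w m : VelocityBundle k E Q} (hm : m ∈ (extChartAt (velocityModel k E) w).source)
    (A : Fin k) (X Z : TangentSpace (velocityModel k E) m) :
    omegaL L A m ![X, Z] =
      fderiv ℝ (fderiv ℝ (chartFun (velocityModel k E) L w)) (extChartAt (velocityModel k E) w m)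
          (extChartDeriv (velocityModel k E) w m Z)
          (vertEndo k E A (extChartDeriv (velocityModel k E) w m X)) -
        fderiv ℝ (fderiv ℝ (chartFun (velocityModel k E) L w))
          (extChartAt (velocityModel k E) w m) (extChartDeriv (velocityModel k E) w m X)
          (vertEndo k E A (extChartDeriv (velocityModel k E) w m Z)) := by
  have hp := (extChartAt (velocityModel k E) w).map_source hm
  have hG := contDiffAt_chartFun hL hp
  have hev := chartForm_thetaL_eventuallyEq hL hp A
  have hd : DifferentiableAt ℝ (chartForm (velocityModel k E) (thetaL L A) w)
      (extChartAt (velocityModel k E) w m) := by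
    refine DifferentiableAt.congr_of_eventuallyEq ?_ hev
    exact ((ContinuousLinearMap.compL ℝ (E × (Fin k → E)) (E × (Fin k → E)) ℝ).flip
      (vertEndo k E A)).differentiableAt.comp _ hG.differentiableAt_fderiv_infty
  change -(extDer (velocityModel k E) (thetaL L A) m ![X, Z]) = _
  rw [extDer_apply_of_mem_source hm hd, hev.fderiv_eq, fderiv_fderiv_comp_apply hG,
    fderiv_fderiv_comp_apply hG, neg_sub]

theorem omegaL_apply_self (hL : ContMDiff (velocityModel k E) 𝓘(ℝ, ℝ) ∞ L)
    (w : VelocityBundle k E Q) (A : Fin k) (X Z : E × (Fin k → E)) :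
    omegaL L A w ![X, Z] =
      fderiv ℝ (fderiv ℝ (chartFun (velocityModel k E) L w)) (extChartAt 𝓘(ℝ, E) w.1 w.1, w.2)
          Z (vertEndo k E A X) -
        fderiv ℝ (fderiv ℝ (chartFun (velocityModel k E) L w))
          (extChartAt 𝓘(ℝ, E) w.1 w.1, w.2) X (vertEndo k E A Z) := by
  have h := omegaL_apply hL (mem_extChartAt_source (I := velocityModel k E) w) A X Z
  rwa [velocityChart_self, extChartDeriv_self (I := velocityModel k E) w X,
    extChartDeriv_self (I := velocityModel k E) w Z] at h

/-- The energy in coordinates. -/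
noncomputable def energyCoord (G : E × (Fin k → E) → ℝ) (p : E × (Fin k → E)) : ℝ :=
  fderiv ℝ G p (0, p.2) - G p

theorem contDiffAt_energyCoord {G : E × (Fin k → E) → ℝ} {p : E × (Fin k → E)}
    (hG : ContDiffAt ℝ ∞ G p) : ContDiffAt ℝ ∞ (energyCoord G) p :=
  ((hG.fderiv_right (m := ∞) (by simp)).clm_apply
    (contDiffAt_const.prodMk contDiffAt_snd)).sub hG

theorem energyL_eq (hL : ContMDiff (velocityModel k E) 𝓘(ℝ, ℝ) ∞ L)
    {w m : VelocityBundle k E Q} (hm : m ∈ (extChartAt (velocityModel k E) w).source) :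
    energyL L m = energyCoord (chartFun (velocityModel k E) L w)
      (extChartAt (velocityModel k E) w m) := by
  rw [energyL, energyCoord, differential_apply hm (hL.mdifferentiable (by simp) _),
    extChartDeriv_liouville hm, chartFun_extChartAt _ hm]

theorem contMDiff_energyL (hL : ContMDiff (velocityModel k E) 𝓘(ℝ, ℝ) ∞ L) :
    ContMDiff (velocityModel k E) 𝓘(ℝ, ℝ) ∞ (energyL L) := by
  intro m
  have hm := mem_extChartAt_source (I := velocityModel k E) m
  have h1 := (contDiffAt_energyCoord (contDiffAt_chartFun hL
    ((extChartAt (velocityModel k E) m).map_source hm))).contMDiffAt.comp m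
    (contMDiffAt_extChartAt (I := velocityModel k E) (n := ∞) (x := m))
  refine h1.congr_of_eventuallyEq ?_
  filter_upwards [extChartAt_source_mem_nhds (I := velocityModel k E) m] with z hz
  exact energyL_eq hL hz

theorem differential_energyL (hL : ContMDiff (velocityModel k E) 𝓘(ℝ, ℝ) ∞ L)
    {w m : VelocityBundle k E Q} (hm : m ∈ (extChartAt (velocityModel k E) w).source)
    (Z : TangentSpace (velocityModel k E) m) :
    differential (energyL L) m Z =
      fderiv ℝ (energyCoord (chartFun (velocityModel k E) L w))
        (extChartAt (velocityModel k E) w m) (extChartDeriv (velocityModel k E) w m Z) := by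
  have hp := (extChartAt (velocityModel k E) w).map_source hm
  have hev : chartFun (velocityModel k E) (energyL L) w =ᶠ[𝓝 (extChartAt (velocityModel k E) w m)]
      energyCoord (chartFun (velocityModel k E) L w) := by
    filter_upwards [(isOpen_extChartAt_target w).mem_nhds hp] with p hp'
    rw [chartFun, energyL_eq hL ((extChartAt (velocityModel k E) w).map_target hp'),
      (extChartAt (velocityModel k E) w).right_inv hp']
  rw [differential_apply hm ((contMDiff_energyL hL).mdifferentiable (by simp) _), hev.fderiv_eq]

end Omega

/-! ### Restriction of a Lagrangian to a fibre. -/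

section Fibre

variable {L : VelocityBundle k E Q → ℝ}

/-- The preferred chart at a point of `T¹ₖQ` depends only on its base point, so all points of a
fibre share it. -/
theorem velocityChart_fibreIncl (w : VelocityBundle k E Q) (v : Fin k → E) :
    extChartAt (velocityModel k E) w (fibreIncl w.1 v) = (extChartAt 𝓘(ℝ, E) w.1 w.1, v) :=
  velocityChart_self (fibreIncl w.1 v)

theorem mk_mem_velocityChart_target (w : VelocityBundle k E Q) (v : Fin k → E) :
    (extChartAt 𝓘(ℝ, E) w.1 w.1, v) ∈ (extChartAt (velocityModel k E) w).target :=
  mem_velocityChart_target.2 (mem_extChartAt_target w.1)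

theorem fibreIncl_eq_chartFun (L : VelocityBundle k E Q → ℝ) (w : VelocityBundle k E Q) :
    (fun v => L (fibreIncl w.1 v)) =
      fun v => chartFun (velocityModel k E) L w (extChartAt 𝓘(ℝ, E) w.1 w.1, v) := by
  funext v
  rw [← velocityChart_fibreIncl, chartFun_extChartAt]
  exact mem_velocityChart_source.2 (mem_extChartAt_source w.1)

theorem fderiv_fibreIncl (hL : ContMDiff (velocityModel k E) 𝓘(ℝ, ℝ) ∞ L)
    (w : VelocityBundle k E Q) (v : Fin k → E) :
    fderiv ℝ (fun v => L (fibreIncl w.1 v)) v =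
      (fderiv ℝ (chartFun (velocityModel k E) L w) (extChartAt 𝓘(ℝ, E) w.1 w.1, v)).comp
        (ContinuousLinearMap.inr ℝ E (Fin k → E)) := by
  rw [fibreIncl_eq_chartFun]
  have h1 := (contDiffAt_chartFun hL (mk_mem_velocityChart_target w v)).differentiableAt (by simp)
  exact (h1.hasFDerivAt.comp v (hasFDerivAt_prodMk_right _ v)).fderiv

/-- This connects `IsRegular`, stated through the fibre Hessian, with the second derivative
occurring in `omegaL_apply`. -/
theorem fderiv_fderiv_fibreIncl (hL : ContMDiff (velocityModel k E) 𝓘(ℝ, ℝ) ∞ L)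
    (w : VelocityBundle k E Q) (v u u' : Fin k → E) :
    fderiv ℝ (fderiv ℝ (fun v => L (fibreIncl w.1 v))) v u u' =
      fderiv ℝ (fderiv ℝ (chartFun (velocityModel k E) L w)) (extChartAt 𝓘(ℝ, E) w.1 w.1, v)
        (0, u) (0, u') := by
  have hG := contDiffAt_chartFun hL (mk_mem_velocityChart_target w v)
  have h : fderiv ℝ (fun v => L (fibreIncl w.1 v)) = _ := funext fun v => fderiv_fibreIncl hL w v
  rw [h]
  have h1 := ((ContinuousLinearMap.compL ℝ (Fin k → E) (E × (Fin k → E)) ℝ).flip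
    (ContinuousLinearMap.inr ℝ E (Fin k → E))).hasFDerivAt.comp v
    (hG.differentiableAt_fderiv_infty.hasFDerivAt.comp v
      (hasFDerivAt_prodMk_right (extChartAt 𝓘(ℝ, E) w.1 w.1) v))
  have h2 : HasFDerivAt (fun v => (fderiv ℝ (chartFun (velocityModel k E) L w)
    (extChartAt 𝓘(ℝ, E) w.1 w.1, v)).comp (ContinuousLinearMap.inr ℝ E (Fin k → E))) _ v := h1
  rw [h2.fderiv]
  rfl

theorem energyL_eq_fibre (hL : ContMDiff (velocityModel k E) 𝓘(ℝ, ℝ) ∞ L)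
    (w : VelocityBundle k E Q) :
    energyL L w = fderiv ℝ (fun v => L (fibreIncl w.1 v)) w.2 w.2 - L w := by
  have hm := mem_extChartAt_source (I := velocityModel k E) w
  rw [energyL_eq hL hm, energyCoord, chartFun_extChartAt _ hm, velocityChart_self]
  congr 1
  exact (DFunLike.congr_fun (fderiv_fibreIncl hL w w.2) w.2).symm

end Fibre

end KSymplectic

/-! ### Linear equations with parameters. -/

section LinearAlgebra

variable {F V D : Type*} [NormedAddCommGroup F] [NormedSpace ℝ F]
  [NormedAddCommGroup V] [NormedSpace ℝ V] [NormedAddCommGroup D] [NormedSpace ℝ D]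

/-- A linear map to the dual of a finite dimensional space is surjective if its range separates
points. -/
theorem ContinuousLinearMap.surjective_of_separating [FiniteDimensional ℝ F]
    (T : V →L[ℝ] (F →L[ℝ] ℝ))
    (h : ∀ Z : F, (∀ Γ, T Γ Z = 0) → Z = 0) : Function.Surjective T := by
  suffices hT : (T : V →ₗ[ℝ] (F →L[ℝ] ℝ)).range = ⊤ from LinearMap.range_eq_top.1 hT
  by_contra hne
  -- A proper range lies in the kernel of a nonzero functional on the dual. By reflexivity this
  -- functional is evaluation at some `Z`, which the hypothesis forces to be zero.
  obtain ⟨f, hf, hker⟩ := Submodule.exists_le_ker_of_lt_top _ (lt_top_iff_ne_top.2 hne)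
  let c : (F →ₗ[ℝ] ℝ) ≃ₗ[ℝ] (F →L[ℝ] ℝ) := LinearMap.toContinuousLinearMap
  obtain ⟨Z, hZ⟩ := (Module.evalEquiv ℝ F).surjective (f ∘ₗ c.toLinearMap)
  have hZ' : ∀ g : F →L[ℝ] ℝ, f g = g Z := fun g => by
    have h1 := DFunLike.congr_fun hZ (c.symm g)
    simp only [Module.evalEquiv_apply, LinearMap.comp_apply, LinearEquiv.coe_coe,
      LinearEquiv.apply_symm_apply] at h1
    exact h1.symm
  have hZ0 : Z = 0 := h Z fun Γ => by
    rw [← hZ']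
    exact hker (LinearMap.mem_range_self (T : V →ₗ[ℝ] (F →L[ℝ] ℝ)) Γ)
  exact hf (LinearMap.ext fun g => by rw [hZ', hZ0, map_zero]; rfl)

/-- A smooth family of linear equations that is solvable at a point for all right hand sides has
smooth local solutions. -/
theorem exists_contDiffOn_solution [FiniteDimensional ℝ D]
    {T : F → V →L[ℝ] D} {d : F → D} {O : Set F} (hO : IsOpen O) {p₀ : F} (hp₀ : p₀ ∈ O)
    (hT : ContDiffOn ℝ ∞ T O) (hd : ContDiffOn ℝ ∞ d O) (hsurj : Function.Surjective (T p₀)) :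
    ∃ U ⊆ O, IsOpen U ∧ p₀ ∈ U ∧ ∃ Γ : F → V, ContDiffOn ℝ ∞ Γ U ∧ ∀ p ∈ U, T p (Γ p) = d p := by
  have : CompleteSpace D := FiniteDimensional.complete ℝ D
  -- A right inverse `R` of `T p₀` is kept fixed: `T p ∘ R` is the identity at `p₀`, hence
  -- invertible nearby, and `R ((T p ∘ R)⁻¹ (d p))` is a smooth solution.
  obtain ⟨g, hg⟩ := (T p₀ : V →ₗ[ℝ] D).exists_rightInverse_of_surjective
    (LinearMap.range_eq_top.2 hsurj)
  let R : D →L[ℝ] V := LinearMap.toContinuousLinearMap g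
  let S : F → D →L[ℝ] D := fun p => (T p).comp R
  have hS : ContDiffOn ℝ ∞ S O := hT.clm_comp contDiffOn_const
  have hS₀ : S p₀ = (ContinuousLinearEquiv.refl ℝ D : D →L[ℝ] D) := by
    refine ContinuousLinearMap.ext fun x => ?_
    exact DFunLike.congr_fun hg x
  refine ⟨O ∩ S ⁻¹' range ((↑) : (D ≃L[ℝ] D) → D →L[ℝ] D), inter_subset_left,
    hS.continuousOn.isOpen_inter_preimage hO ContinuousLinearEquiv.isOpen,
    ⟨hp₀, ⟨_, hS₀.symm⟩⟩, fun p => R ((S p).inverse (d p)), ?_, ?_⟩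
  · rintro p ⟨hp, e, he⟩
    have h1 : ContDiffAt ℝ ∞ S p := hS.contDiffAt (hO.mem_nhds hp)
    have h2 : ContDiffAt ℝ ∞ (fun p => (S p).inverse) p := by
      have h3 := contDiffAt_map_inverse (n := ∞) e
      rw [he] at h3
      exact h3.comp p h1
    exact (R.contDiff.contDiffAt.comp p
      (h2.clm_apply (hd.contDiffAt (hO.mem_nhds hp)))).contDiffWithinAt
  · rintro p ⟨hp, e, he⟩
    change S p ((S p).inverse (d p)) = d p
    rw [← he, ContinuousLinearMap.inverse_equiv]
    exact e.apply_symm_apply _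

end LinearAlgebra

/-! ### Existence of solutions for a regular Lagrangian. -/

namespace KSymplectic

variable {k : ℕ} {E : Type*} [NormedAddCommGroup E] [NormedSpace ℝ E]

section Coordinates

/-- The map `(Γ_1, …, Γ_k) ↦ ∑_A i(Γ_A) ω^A`, where
`ω^A(X, Z) = B(J_A X, Z) - B(X, J_A Z)`. -/
noncomputable def contraction {F : Type*} [NormedAddCommGroup F] [NormedSpace ℝ F]
    (J : Fin k → F →L[ℝ] F) (B : F →L[ℝ] F →L[ℝ] ℝ) : (Fin k → F) →L[ℝ] (F →L[ℝ] ℝ) :=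
  ∑ A, (B.comp (J A) - ((ContinuousLinearMap.compL ℝ F F ℝ).flip (J A)).comp B).comp
    (ContinuousLinearMap.proj A)

theorem contraction_apply {F : Type*} [NormedAddCommGroup F] [NormedSpace ℝ F]
    (J : Fin k → F →L[ℝ] F) (B : F →L[ℝ] F →L[ℝ] ℝ) (Γ : Fin k → F) (Z : F) :
    contraction J B Γ Z = ∑ A, (B (J A (Γ A)) Z - B (Γ A) (J A Z)) := by
  rw [contraction, sum_apply, sum_apply]
  rfl

theorem contDiffOn_contraction {F F' : Type*} [NormedAddCommGroup F] [NormedSpace ℝ F]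
    [NormedAddCommGroup F'] [NormedSpace ℝ F'] (J : Fin k → F →L[ℝ] F)
    {B : F' → F →L[ℝ] F →L[ℝ] ℝ} {O : Set F'}
    (hB : ContDiffOn ℝ ∞ B O) : ContDiffOn ℝ ∞ (fun p => contraction J (B p)) O := by
  refine ContDiffOn.sum fun A _ => ContDiffOn.clm_comp (ContDiffOn.sub ?_ ?_) contDiffOn_const
  · exact hB.clm_comp contDiffOn_const
  · exact contDiffOn_const.clm_comp hB

theorem zero_mk_eq_sum_vertEndo (u : Fin k → E) :
    ((0, u) : E × (Fin k → E)) = ∑ A, vertEndo k E A (u A, 0) := by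
  refine Prod.ext ?_ ?_
  · simp [vertEndo_apply, Prod.fst_sum]
  · simp only [vertEndo_apply, Prod.snd_sum]
    exact (Finset.univ_sum_single u).symm

/-- Let `Z` be in the common kernel of the `ω^A`. Testing against `X = (0, u')`, where `J_A X = 0`,
leaves `B(X, J_A Z) = 0`, so `J_A Z = 0` by nondegeneracy; a single index `A`, available since `1 ≤
k`, then gives `Z.1 = 0`. Testing against `X = (x, 0)` leaves `B(J_A X, Z) = 0` for every `A`,
whence `Z.2 = 0`. -/
theorem contraction_separating (hk : 1 ≤ k)
    {B : E × (Fin k → E) →L[ℝ] E × (Fin k → E) →L[ℝ] ℝ} (hsymm : ∀ X Y, B X Y = B Y X)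
    (hB : ∀ u : Fin k → E, (∀ u' : Fin k → E, B (0, u) (0, u') = 0) → u = 0)
    (Z : E × (Fin k → E)) (hZ : ∀ Γ, contraction (vertEndo k E) B Γ Z = 0) : Z = 0 := by
  have h : ∀ A X, B (vertEndo k E A X) Z - B X (vertEndo k E A Z) = 0 := fun A X => by
    have h1 := hZ (Pi.single A X)
    rw [contraction_apply, Finset.sum_eq_single A] at h1
    · simpa using h1
    · intro A' _ hA
      simp [Pi.single_eq_of_ne hA]
    · simp
  have hZ1 : Z.1 = 0 := by
    let A : Fin k := ⟨0, hk⟩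
    have h1 : (Pi.single A Z.1 : Fin k → E) = 0 := hB _ fun u' => by
      have h2 := h A (0, u')
      rw [hsymm]
      simpa [vertEndo_apply, Prod.mk_zero_zero] using h2
    simpa using congrFun h1 A
  have hZ2 : Z.2 = 0 := hB _ fun u' => by
    have hZ' : Z = (0, Z.2) := Prod.ext hZ1 rfl
    rw [← hZ']
    rw [zero_mk_eq_sum_vertEndo, map_sum]
    refine Finset.sum_eq_zero fun A _ => ?_
    rw [hsymm]
    have h2 := h A (u' A, 0)
    simpa [vertEndo_apply, hZ1, Prod.mk_zero_zero] using h2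
  exact Prod.ext hZ1 hZ2

end Coordinates

variable {Q : Type*} [TopologicalSpace Q] [ChartedSpace E Q] [IsManifold 𝓘(ℝ, E) ∞ Q]
variable {L : VelocityBundle k E Q → ℝ}

theorem contraction_surjective [FiniteDimensional ℝ E] (hk : 1 ≤ k)
    (hL : ContMDiff (velocityModel k E) 𝓘(ℝ, ℝ) ∞ L) (hreg : IsRegular L)
    (w : VelocityBundle k E Q) :
    Function.Surjective (contraction (vertEndo k E)
      (fderiv ℝ (fderiv ℝ (chartFun (velocityModel k E) L w))
        (extChartAt (velocityModel k E) w w))) := by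
  refine ContinuousLinearMap.surjective_of_separating _ ?_
  rw [velocityChart_self]
  have hG := contDiffAt_chartFun hL (mk_mem_velocityChart_target w w.2)
  refine contraction_separating hk (fun X Y => ?_) fun u hu => hreg w u fun u' => ?_
  · exact hG.isSymmSndFDerivAt
      (by rw [minSmoothness_of_isRCLikeNormedField]; exact ENat.LEInfty.out) X Y
  · exact (fderiv_fderiv_fibreIncl hL w w.2 u u').trans (hu u')

/-- Local existence of smooth solutions of `∑_A i(Γ_A) ω_L^A = dE_L` for regular `L`. -/
theorem exists_local_solution [FiniteDimensional ℝ E] (hk : 1 ≤ k)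
    (hL : ContMDiff (velocityModel k E) 𝓘(ℝ, ℝ) ∞ L) (hreg : IsRegular L)
    (w : VelocityBundle k E Q) :
    ∃ U : Set (VelocityBundle k E Q), IsOpen U ∧ w ∈ U ∧
      ∃ Γ : Fin k → (m : VelocityBundle k E Q) → TangentSpace (velocityModel k E) m,
        (∀ A, ContMDiffOn (velocityModel k E) ((velocityModel k E).prod 𝓘(ℝ, E × (Fin k → E))) ∞
          (fun m => TotalSpace.mk' (E × (Fin k → E)) m (Γ A m)) U) ∧
        ∀ m ∈ U, ∀ Z : TangentSpace (velocityModel k E) m,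
          ∑ A, omegaL L A m ![Γ A m, Z] = differential (energyL L) m Z := by
  let φ := extChartAt (velocityModel k E) w
  let G := chartFun (velocityModel k E) L w
  have hGon : ContDiffOn ℝ ∞ G φ.target := fun p hp => (contDiffAt_chartFun hL hp).contDiffWithinAt
  have hO : IsOpen φ.target := isOpen_extChartAt_target w
  have hB : ContDiffOn ℝ ∞ (fderiv ℝ (fderiv ℝ G)) φ.target :=
    (hGon.fderiv_of_isOpen hO (m := ∞) (by simp)).fderiv_of_isOpen hO (by simp)
  have hen : ContDiffOn ℝ ∞ (fderiv ℝ (energyCoord G)) φ.target :=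
    ContDiffOn.fderiv_of_isOpen (n := ∞)
      (fun p hp => (contDiffAt_energyCoord (contDiffAt_chartFun hL hp)).contDiffWithinAt) hO
      (by simp)
  obtain ⟨U, hUO, hU, hwU, Γ, hΓ, hsol⟩ := exists_contDiffOn_solution hO (mem_extChartAt_target w)
    (contDiffOn_contraction (vertEndo k E) hB) hen (contraction_surjective hk hL hreg w)
  let e := trivializationAt (E × (Fin k → E)) (TangentSpace (velocityModel k E)) w
  -- The inverse of the trivialization inverts the chart derivative, so the lifted fields have the
  -- coordinates `Γ`.
  have hext : ∀ m ∈ φ.source, ∀ v : E × (Fin k → E),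
      extChartDeriv (velocityModel k E) w m (e.symmL ℝ m v) = v := fun m hm v => by
    have hm' : m ∈ (chartAt (ModelProd E (Fin k → E)) w).source := by
      rwa [← extChartAt_source (velocityModel k E)]
    have h1 := e.continuousLinearMapAt_symmL (R := ℝ) (b := m) hm' v
    rwa [TangentBundle.continuousLinearMapAt_trivializationAt hm'] at h1
  refine ⟨φ.source ∩ φ ⁻¹' U, ?_, ⟨mem_extChartAt_source w, hwU⟩,
    fun A m => e.symmL ℝ m (Γ (φ m) A), fun A => ?_, ?_⟩
  · exact (continuousOn_extChartAt w).isOpen_inter_preimage (isOpen_extChartAt_source w) hU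
  · have hsub : φ.source ∩ φ ⁻¹' U ⊆ e.baseSet := fun m hm => by
      have := hm.1
      rwa [extChartAt_source] at this
    rw [e.contMDiffOn_section_iff ((continuousOn_extChartAt w).isOpen_inter_preimage
      (isOpen_extChartAt_source w) hU) hsub]
    have h1 : ContMDiffOn (velocityModel k E) 𝓘(ℝ, E × (Fin k → E)) ∞ (fun m => Γ (φ m) A)
        (φ.source ∩ φ ⁻¹' U) := by
      have h2 : ContDiffOn ℝ ∞ (fun p => Γ p A) U :=
        (contDiff_apply ℝ _ A).comp_contDiffOn hΓ
      refine h2.contMDiffOn.comp (t := U) ?_ fun m hm => hm.2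
      refine (contMDiffOn_extChartAt (I := velocityModel k E) (n := ∞) (x := w)).mono fun m hm => ?_
      have := hm.1
      rwa [extChartAt_source] at this
    refine h1.congr fun m hm => ?_
    change (e (TotalSpace.mk' (E × (Fin k → E)) m (e.symmL ℝ m (Γ (φ m) A)))).2 = _
    rw [e.symmL_apply (hsub hm), e.apply_mk_symm (hsub hm)]
  · rintro m ⟨hm, hmU⟩ Z
    have h1 := DFunLike.congr_fun (hsol _ hmU) (extChartDeriv (velocityModel k E) w m Z)
    rw [contraction_apply] at h1
    rw [differential_energyL hL hm]
    refine Eq.trans (Finset.sum_congr rfl fun A _ => ?_) h1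
    -- Symmetry of the second derivative turns `B(Z, J_A X)` in `ω_L^A` into the `B(J_A X, Z)` of
    -- `contraction`.
    rw [omegaL_apply hL hm, hext m hm, (contDiffAt_chartFun hL
      (φ.map_source hm)).isSymmSndFDerivAt (by
        rw [minSmoothness_of_isRCLikeNormedField]; exact ENat.LEInfty.out)]

/-- The equation is affine in `Γ`: weights with `a + b = 1` preserve its right-hand side. This is
what permits gluing. -/
theorem convex_solutions (m : VelocityBundle k E Q) :
    Convex ℝ {Γ : Fin k → TangentSpace (velocityModel k E) m |
      ∀ Z : TangentSpace (velocityModel k E) m,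
        ∑ A, omegaL L A m ![Γ A, Z] = differential (energyL L) m Z} := by
  intro Γ hΓ Γ' hΓ' a b _ _ hab Z
  have hlin : ∀ A, omegaL L A m ![(a • Γ + b • Γ') A, Z] =
      a * omegaL L A m ![Γ A, Z] + b * omegaL L A m ![Γ' A, Z] := fun A => by
    rw [Pi.add_apply, Pi.smul_apply, Pi.smul_apply]
    have h1 := (omegaL L A m).cons_add ![Z] (a • Γ A) (b • Γ' A)
    have h2 := (omegaL L A m).cons_smul ![Z] a (Γ A)
    have h3 := (omegaL L A m).cons_smul ![Z] b (Γ' A)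
    rw [h2, h3, smul_eq_mul, smul_eq_mul] at h1
    exact h1
  rw [Finset.sum_congr rfl fun A _ => hlin A, Finset.sum_add_distrib, ← Finset.mul_sum,
    ← Finset.mul_sum, hΓ Z, hΓ' Z, ← add_mul, hab, one_mul]

/-- Equality of solution sets carries information about the energies only if a solution exists. The
topological hypotheses on `Q` make `T¹ₖQ` Hausdorff, locally compact and second countable, so that
partitions of unity are available. -/
theorem solutionFields_nonempty [FiniteDimensional ℝ E] [T2Space Q] [ParacompactSpace Q]
    [ConnectedSpace Q] (hk : 1 ≤ k)
    (hL : ContMDiff (velocityModel k E) 𝓘(ℝ, ℝ) ∞ L) (hreg : IsRegular L) :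
    (solutionFields L).Nonempty := by
  have : LocallyCompactSpace Q := Manifold.locallyCompact_of_finiteDimensional 𝓘(ℝ, E)
  have : SigmaCompactSpace Q := sigmaCompactSpace_of_connected_paracompact Q
  have : LocallyCompactSpace (VelocityBundle k E Q) :=
    Manifold.locallyCompact_of_finiteDimensional (velocityModel k E)
  have : T2Space (VelocityBundle k E Q) := FiberBundle.t2Space_totalSpace _
  have : SecondCountableTopology E :=
    have := FiniteDimensional.proper ℝ E
    inferInstance
  have : SecondCountableTopology (VelocityBundle k E Q) :=
    FiberBundle.secondCountableTopology_totalSpace (H := E) _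
  obtain ⟨Γ, hΓ, hsol⟩ := exists_contMDiff_sections_forall_mem_convex_of_local
    (I := velocityModel k E) (F' := E × (Fin k → E)) (ι := Fin k)
    (TangentSpace (velocityModel k E) : VelocityBundle k E Q → Type _)
    (fun m => {Γ | ∀ Z : TangentSpace (velocityModel k E) m,
      ∑ A, omegaL L A m ![Γ A, Z] = differential (energyL L) m Z})
    convex_solutions (exists_local_solution hk hL hreg)
  exact ⟨Γ, hΓ, hsol⟩

end KSymplectic

namespace KSymplectic

variable {k : ℕ} {E : Type*} [NormedAddCommGroup E] [NormedSpace ℝ E]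
variable {Q : Type*} [TopologicalSpace Q] [ChartedSpace E Q] [IsManifold 𝓘(ℝ, E) ∞ Q]
variable {L L₁ L₂ : VelocityBundle k E Q → ℝ}

/-! ### The forms `ω_L^A` and differences of Lagrangians -/

theorem fderiv_fderiv_chartFun_sub (hL₁ : ContMDiff (velocityModel k E) 𝓘(ℝ, ℝ) ∞ L₁)
    (hL₂ : ContMDiff (velocityModel k E) 𝓘(ℝ, ℝ) ∞ L₂) {w : VelocityBundle k E Q}
    {p : E × (Fin k → E)} (hp : p ∈ (extChartAt (velocityModel k E) w).target) :
    fderiv ℝ (fderiv ℝ (chartFun (velocityModel k E) (fun z => L₁ z - L₂ z) w)) p =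
      fderiv ℝ (fderiv ℝ (chartFun (velocityModel k E) L₁ w)) p -
        fderiv ℝ (fderiv ℝ (chartFun (velocityModel k E) L₂ w)) p := by
  have hev : fderiv ℝ (chartFun (velocityModel k E) (fun z => L₁ z - L₂ z) w) =ᶠ[𝓝 p]
      fun p => fderiv ℝ (chartFun (velocityModel k E) L₁ w) p -
        fderiv ℝ (chartFun (velocityModel k E) L₂ w) p := by
    filter_upwards [(isOpen_extChartAt_target w).mem_nhds hp] with y hy
    exact fderiv_fun_sub ((contDiffAt_chartFun hL₁ hy).differentiableAt (by simp))
      ((contDiffAt_chartFun hL₂ hy).differentiableAt (by simp))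
  rw [hev.fderiv_eq]
  exact fderiv_fun_sub (contDiffAt_chartFun hL₁ hp).differentiableAt_fderiv_infty
    (contDiffAt_chartFun hL₂ hp).differentiableAt_fderiv_infty

/-- By linearity in `L`, the condition is that the 2-form built from `L₁ - L₂` vanishes, and that
form is the antisymmetrization of `D²(L₁ - L₂)(·, J_A ·)`. -/
theorem omegaL_eq_iff (hL₁ : ContMDiff (velocityModel k E) 𝓘(ℝ, ℝ) ∞ L₁)
    (hL₂ : ContMDiff (velocityModel k E) 𝓘(ℝ, ℝ) ∞ L₂) (A : Fin k) :
    omegaL L₁ A = omegaL L₂ A ↔ ∀ (w : VelocityBundle k E Q) (X Z : E × (Fin k → E)),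
      fderiv ℝ (fderiv ℝ (chartFun (velocityModel k E) (fun z => L₁ z - L₂ z) w))
          (extChartAt 𝓘(ℝ, E) w.1 w.1, w.2) X (vertEndo k E A Z) =
        fderiv ℝ (fderiv ℝ (chartFun (velocityModel k E) (fun z => L₁ z - L₂ z) w))
          (extChartAt 𝓘(ℝ, E) w.1 w.1, w.2) Z (vertEndo k E A X) := by
  have key : ∀ (w : VelocityBundle k E Q) (X Z : E × (Fin k → E)),
      omegaL L₁ A w ![X, Z] = omegaL L₂ A w ![X, Z] ↔
      fderiv ℝ (fderiv ℝ (chartFun (velocityModel k E) (fun z => L₁ z - L₂ z) w))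
          (extChartAt 𝓘(ℝ, E) w.1 w.1, w.2) X (vertEndo k E A Z) =
        fderiv ℝ (fderiv ℝ (chartFun (velocityModel k E) (fun z => L₁ z - L₂ z) w))
          (extChartAt 𝓘(ℝ, E) w.1 w.1, w.2) Z (vertEndo k E A X) := fun w X Z => by
    rw [omegaL_apply_self hL₁, omegaL_apply_self hL₂,
      fderiv_fderiv_chartFun_sub hL₁ hL₂ (mk_mem_velocityChart_target w w.2)]
    simp only [sub_apply]
    constructor <;> intro h <;> linarith
  constructor
  · intro h w X Z
    exact (key w X Z).1 (by rw [h])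
  · intro h
    funext w
    refine ContinuousAlternatingMap.ext fun v => ?_
    have hv : v = ![v 0, v 1] := by
      funext i
      fin_cases i <;> rfl
    rw [hv]
    exact (key w (v 0) (v 1)).2 (h w (v 0) (v 1))

/-! ### The 1-forms defined by the fibre derivative along the zero section -/

/-- The `A`-th component of the fibre derivative of `f` along the zero section, a 1-form on `Q`. -/
noncomputable def fibreForm (f : VelocityBundle k E Q → ℝ) (A : Fin k) (q : Q) :
    TangentSpace 𝓘(ℝ, E) q →L[ℝ] ℝ :=
  (fderiv ℝ (fun v : Fin k → E => f (fibreIncl q v)) 0).comp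
    (ContinuousLinearMap.single ℝ (fun _ : Fin k => E) A)

/-- Both sides are the differential of `L` on the vertical lift of `u`, computed in the chart at `m`
and in the chart at `w`. -/
theorem fderiv_fibreIncl_of_mem_source (hL : ContMDiff (velocityModel k E) 𝓘(ℝ, ℝ) ∞ L)
    {w m : VelocityBundle k E Q} (hm : m ∈ (extChartAt (velocityModel k E) w).source)
    (u : Fin k → E) :
    fderiv ℝ (fun v : Fin k → E => L (fibreIncl m.1 v)) m.2 u =
      fderiv ℝ (chartFun (velocityModel k E) L w) (extChartAt (velocityModel k E) w m)
        (0, fun A => extChartDeriv 𝓘(ℝ, E) w.1 m.1 (u A)) := by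
  have hd := hL.mdifferentiable (by simp) m
  have h1 := differential_apply hm hd (verticalLift m u)
  have h2 := differential_apply (mem_extChartAt_source m) hd (verticalLift m u)
  rw [extChartDeriv_verticalLift hm] at h1
  rw [extChartDeriv_verticalLift (mem_extChartAt_source m), velocityChart_self, h1] at h2
  rw [h2]
  have h3 : (fun A => extChartDeriv 𝓘(ℝ, E) m.1 m.1 (u A)) = u :=
    funext fun A => extChartDeriv_self m.1 (u A)
  rw [h3]
  exact DFunLike.congr_fun (fderiv_fibreIncl hL m m.2) u

theorem chartForm_fibreForm (hL : ContMDiff (velocityModel k E) 𝓘(ℝ, ℝ) ∞ L) {q : Q} {y : E}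
    (hy : y ∈ (extChartAt 𝓘(ℝ, E) q).target) (A : Fin k) :
    chartForm 𝓘(ℝ, E) (fibreForm L A) q y =
      (fderiv ℝ (chartFun (velocityModel k E) L (fibreIncl q 0)) (y, 0)).comp
        ((ContinuousLinearMap.inr ℝ E (Fin k → E)).comp
          (ContinuousLinearMap.single ℝ (fun _ : Fin k => E) A)) := by
  refine ContinuousLinearMap.ext fun e => ?_
  let m : VelocityBundle k E Q := fibreIncl ((extChartAt 𝓘(ℝ, E) q).symm y) 0
  have hm : m ∈ (extChartAt (velocityModel k E) (fibreIncl (k := k) (E := E) q 0)).source :=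
    mem_velocityChart_source.2 ((extChartAt 𝓘(ℝ, E) q).map_target hy)
  have hφ : extChartAt (velocityModel k E) (fibreIncl (k := k) (E := E) q 0) m = (y, 0) := by
    rw [velocityChart_apply (mem_velocityChart_source.1 hm)]
    exact Prod.ext ((extChartAt 𝓘(ℝ, E) q).right_inv hy) (funext fun B => map_zero _)
  have h := fderiv_fibreIncl_of_mem_source hL hm (Pi.single A (chartSymmDeriv 𝓘(ℝ, E) q y e))
  rw [hφ] at h
  refine h.trans ?_
  rw [ContinuousLinearMap.comp_apply]
  congr 1
  refine Prod.ext rfl ((extChartDeriv_single q _ A (chartSymmDeriv 𝓘(ℝ, E) q y e)).trans ?_)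
  exact congrArg (fun u => (Pi.single A u : Fin k → E)) (extChartDeriv_chartSymmDeriv hy e)

theorem contDiffOn_chartForm_fibreForm (hL : ContMDiff (velocityModel k E) 𝓘(ℝ, ℝ) ∞ L) (q : Q)
    (A : Fin k) :
    ContDiffOn ℝ ∞ (chartForm 𝓘(ℝ, E) (fibreForm L A) q) (extChartAt 𝓘(ℝ, E) q).target := by
  refine ContDiffOn.congr (fun y hy => ?_) fun y hy => chartForm_fibreForm hL hy A
  have hp : (y, 0) ∈ (extChartAt (velocityModel k E) (fibreIncl (k := k) (E := E) q 0)).target :=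
    mem_velocityChart_target.2 hy
  have h1 : ContDiffAt ℝ ∞ (fderiv ℝ (chartFun (velocityModel k E) L (fibreIncl q 0))) (y, 0) :=
    (contDiffAt_chartFun hL hp).fderiv_right (m := ∞) (by simp)
  have h2 : ContDiffAt ℝ ∞ (fun y : E => (y, (0 : Fin k → E))) y :=
    contDiffAt_id.prodMk contDiffAt_const
  exact ((h1.comp y h2).clm_comp contDiffAt_const).contDiffWithinAt

theorem isSmoothForm_of_chartForm {α : (q : Q) → TangentSpace 𝓘(ℝ, E) q →L[ℝ] ℝ}
    (hα : ∀ q, ContDiffOn ℝ ∞ (chartForm 𝓘(ℝ, E) α q) (extChartAt 𝓘(ℝ, E) q).target) :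
    IsSmoothForm α := by
  intro q
  rw [contMDiffAt_hom_bundle]
  refine ⟨contMDiffAt_id, ?_⟩
  have h1 : ContMDiffAt 𝓘(ℝ, E) 𝓘(ℝ, E →L[ℝ] ℝ) ∞
      (chartForm 𝓘(ℝ, E) α q ∘ extChartAt 𝓘(ℝ, E) q) q :=
    ((hα q).contDiffAt ((isOpen_extChartAt_target q).mem_nhds
      (mem_extChartAt_target q))).contMDiffAt.comp q (contMDiffAt_extChartAt (n := ∞))
  refine h1.congr_of_eventuallyEq ?_
  filter_upwards [extChartAt_source_mem_nhds (I := 𝓘(ℝ, E)) q] with m hm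
  have hm' : m ∈ (chartAt E q).source := by rwa [← extChartAt_source 𝓘(ℝ, E)]
  refine ContinuousLinearMap.ext fun u => ?_
  have h2 := chartForm_extChartDeriv α hm
    ((trivializationAt E (TangentSpace 𝓘(ℝ, E)) q).symmL ℝ m u)
  have h3 := (trivializationAt E (TangentSpace 𝓘(ℝ, E)) q).continuousLinearMapAt_symmL (R := ℝ)
    (b := m) hm' u
  rw [TangentBundle.continuousLinearMapAt_trivializationAt hm'] at h3
  have h4 : extChartDeriv 𝓘(ℝ, E) q m
    ((trivializationAt E (TangentSpace 𝓘(ℝ, E)) q).symmL ℝ m u) = u := h3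
  rw [h4] at h2
  refine Eq.trans ?_ h2.symm
  change (trivializationAt ℝ (Bundle.Trivial Q ℝ) q).continuousLinearMapAt ℝ m
    (α m ((trivializationAt E (TangentSpace 𝓘(ℝ, E)) q).symmL ℝ m u)) = _
  exact DFunLike.congr_fun (Bundle.Trivial.continuousLinearMapAt_trivialization ℝ Q ℝ m) _

/-- In the chart the form is `∂L/∂v_A` at `(y, 0)`. Its derivative along `X`, paired with `Z`, is
`D²L((X, 0), J_A (Z, 0))`, so `hsymm` on horizontal vectors is closedness. -/
theorem extDer_fibreForm_eq_zero (hL : ContMDiff (velocityModel k E) 𝓘(ℝ, ℝ) ∞ L) (A : Fin k)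
    (q : Q)
    (hsymm : ∀ X Z : E × (Fin k → E),
      fderiv ℝ (fderiv ℝ (chartFun (velocityModel k E) L (fibreIncl q 0)))
          (extChartAt 𝓘(ℝ, E) q q, 0) X (vertEndo k E A Z) =
        fderiv ℝ (fderiv ℝ (chartFun (velocityModel k E) L (fibreIncl q 0)))
          (extChartAt 𝓘(ℝ, E) q q, 0) Z (vertEndo k E A X)) :
    extDer 𝓘(ℝ, E) (fibreForm L A) q = 0 := by
  let C : E →L[ℝ] E × (Fin k → E) := (ContinuousLinearMap.inr ℝ E (Fin k → E)).comp
    (ContinuousLinearMap.single ℝ (fun _ : Fin k => E) A)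
  have hd : DifferentiableAt ℝ (chartForm 𝓘(ℝ, E) (fibreForm L A) q) (extChartAt 𝓘(ℝ, E) q q) :=
    ((contDiffOn_chartForm_fibreForm hL q A).contDiffAt ((isOpen_extChartAt_target q).mem_nhds
      (mem_extChartAt_target q))).differentiableAt (by simp)
  have hev : chartForm 𝓘(ℝ, E) (fibreForm L A) q =ᶠ[𝓝 (extChartAt 𝓘(ℝ, E) q q)]
      fun y => (fderiv ℝ (chartFun (velocityModel k E) L (fibreIncl q 0)) (y, 0)).comp C :=
    eventually_of_mem (extChartAt_target_mem_nhds q) fun y hy => chartForm_fibreForm hL hy A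
  have hG := contDiffAt_chartFun hL (mk_mem_velocityChart_target (fibreIncl (E := E) q 0) 0)
  have hval : ∀ X Z : E, fderiv ℝ (chartForm 𝓘(ℝ, E) (fibreForm L A) q)
      (extChartAt 𝓘(ℝ, E) q q) X Z =
      fderiv ℝ (fderiv ℝ (chartFun (velocityModel k E) L (fibreIncl q 0)))
        (extChartAt 𝓘(ℝ, E) q q, 0) (X, 0) (vertEndo k E A (Z, 0)) := fun X Z => by
    have h1 := ((ContinuousLinearMap.compL ℝ E (E × (Fin k → E)) ℝ).flip C).hasFDerivAt.comp
      (extChartAt 𝓘(ℝ, E) q q) (hG.differentiableAt_fderiv_infty.hasFDerivAt.comp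
        (extChartAt 𝓘(ℝ, E) q q) (hasFDerivAt_prodMk_left _ (0 : Fin k → E)))
    have h2 : HasFDerivAt (fun y => (fderiv ℝ (chartFun (velocityModel k E) L (fibreIncl q 0))
      (y, 0)).comp C) _ (extChartAt 𝓘(ℝ, E) q q) := h1
    rw [hev.fderiv_eq, h2.fderiv]
    rfl
  refine ContinuousAlternatingMap.ext fun v => ?_
  have hv : v = ![v 0, v 1] := by
    funext i
    fin_cases i <;> rfl
  rw [hv, extDer_apply_of_mem_source (mem_extChartAt_source q) hd, hval, hval, hsymm, sub_self]
  rfl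

end KSymplectic

/-! ### Functions affine on the fibres and their effect on the energy. -/

namespace KSymplectic

variable {k : ℕ} {E : Type*} [NormedAddCommGroup E] [NormedSpace ℝ E]
variable {Q : Type*} [TopologicalSpace Q] [ChartedSpace E Q] [IsManifold 𝓘(ℝ, E) ∞ Q]
variable {L L₁ L₂ : VelocityBundle k E Q → ℝ}

theorem contDiff_fibreIncl (hL : ContMDiff (velocityModel k E) 𝓘(ℝ, ℝ) ∞ L) (q : Q) :
    ContDiff ℝ ∞ (fun v : Fin k → E => L (fibreIncl q v)) :=
  (hL.comp (contMDiff_fibreIncl q)).contDiff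

/-- A function with vanishing fibre Hessian is affine on the fibres. -/
theorem eq_hat_fibreForm_add (hL : ContMDiff (velocityModel k E) 𝓘(ℝ, ℝ) ∞ L)
    (hH : ∀ (q : Q) (v u u' : Fin k → E),
      fderiv ℝ (fderiv ℝ (fun v : Fin k → E => L (fibreIncl q v))) v u u' = 0)
    (q : Q) (v : Fin k → E) :
    L (fibreIncl q v) = hat (fibreForm L) (fibreIncl q v) + L (fibreIncl q 0) := by
  set H : (Fin k → E) → ℝ := fun v => L (fibreIncl q v) with hHdef
  have hC : ContDiff ℝ ∞ H := contDiff_fibreIncl hL q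
  have hconst : ∀ v, fderiv ℝ H v = fderiv ℝ H 0 := fun v =>
    is_const_of_fderiv_eq_zero (𝕜 := ℝ) ((hC.fderiv_right (m := ∞) (by simp)).differentiable
      (by simp)) (fun x => ContinuousLinearMap.ext fun u => ContinuousLinearMap.ext fun u' =>
        hH q x u u') v 0
  have hd : ∀ v, HasFDerivAt (fun v => H v - fderiv ℝ H 0 v) (0 : (Fin k → E) →L[ℝ] ℝ) v :=
    fun v => by
      have h1 := ((hC.differentiable (by simp) v).hasFDerivAt).fun_sub
        (fderiv ℝ H 0).hasFDerivAt
      rwa [hconst v, sub_self] at h1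
  have h2 : H v - fderiv ℝ H 0 v = H 0 - fderiv ℝ H 0 0 :=
    is_const_of_fderiv_eq_zero (𝕜 := ℝ) (fun x => (hd x).differentiableAt)
      (fun x => (hd x).fderiv) v 0
  have h3 : hat (fibreForm L) (fibreIncl q v) = fderiv ℝ H 0 v := by
    change ∑ A, fderiv ℝ H 0 (Pi.single A (v A)) = _
    exact (map_sum (fderiv ℝ H 0) _ _).symm.trans
      (congrArg _ (Finset.univ_sum_single (M := fun _ => E) v))
  rw [map_zero, sub_zero] at h2
  change H v = _ + H 0
  rw [h3, ← h2]
  ring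

/-- Every vertical vector is a sum of values of the `J_A`; `hsymm` moves `J_A` onto the other
argument `(0, u)`, which it kills. -/
theorem fibreHessian_eq_zero (hL : ContMDiff (velocityModel k E) 𝓘(ℝ, ℝ) ∞ L)
    (w : VelocityBundle k E Q) (v : Fin k → E)
    (hsymm : ∀ (A : Fin k) (X Z : E × (Fin k → E)),
      fderiv ℝ (fderiv ℝ (chartFun (velocityModel k E) L w))
          (extChartAt 𝓘(ℝ, E) w.1 w.1, v) X (vertEndo k E A Z) =
        fderiv ℝ (fderiv ℝ (chartFun (velocityModel k E) L w))
          (extChartAt 𝓘(ℝ, E) w.1 w.1, v) Z (vertEndo k E A X)) (u u' : Fin k → E) :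
    fderiv ℝ (fderiv ℝ (fun v : Fin k → E => L (fibreIncl w.1 v))) v u u' = 0 := by
  rw [fderiv_fderiv_fibreIncl hL, zero_mk_eq_sum_vertEndo u', map_sum]
  refine Finset.sum_eq_zero fun A _ => ?_
  rw [hsymm, vertEndo_apply, Pi.single_zero, Prod.mk_zero_zero, map_zero]

/-- `Δ(α̂) = α̂`, so the linear part drops out of the energy. The hypothesis concerns only the fibre
of `w`, so `c` may vary with the base point; necessity uses it with `c = g(w.1)`. -/
theorem energyL_eq_sub_of_affine (hL₁ : ContMDiff (velocityModel k E) 𝓘(ℝ, ℝ) ∞ L₁)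
    (hL₂ : ContMDiff (velocityModel k E) 𝓘(ℝ, ℝ) ∞ L₂)
    (α : Fin k → (q : Q) → TangentSpace 𝓘(ℝ, E) q →L[ℝ] ℝ) (w : VelocityBundle k E Q) (c : ℝ)
    (h : ∀ v : Fin k → E, L₁ (fibreIncl w.1 v) =
      L₂ (fibreIncl w.1 v) + hat α (fibreIncl w.1 v) + c) :
    energyL L₁ w = energyL L₂ w - c := by
  let Λ : (Fin k → E) →L[ℝ] ℝ :=
    ∑ A, (α A w.1 : E →L[ℝ] ℝ).comp (ContinuousLinearMap.proj A)
  have hΛ : ∀ v : Fin k → E, hat α (fibreIncl w.1 v) = Λ v := fun v => by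
    rw [sum_apply]
    rfl
  have h1 : (fun v : Fin k → E => L₁ (fibreIncl w.1 v)) =
      fun v => L₂ (fibreIncl w.1 v) + Λ v + c := funext fun v => by rw [h, hΛ]
  have h2 : HasFDerivAt (fun v : Fin k → E => L₂ (fibreIncl w.1 v) + Λ v + c)
      (fderiv ℝ (fun v : Fin k → E => L₂ (fibreIncl w.1 v)) w.2 + Λ) w.2 :=
    (((contDiff_fibreIncl hL₂ w.1).differentiable (by simp) _).hasFDerivAt.fun_add
      Λ.hasFDerivAt).add_const c
  have h3 : L₁ w = L₂ w + Λ w.2 + c := congrFun h1 w.2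
  have h4 : fderiv ℝ (fun v : Fin k → E => L₁ (fibreIncl w.1 v)) w.2 w.2 =
      fderiv ℝ (fun v : Fin k → E => L₂ (fibreIncl w.1 v)) w.2 w.2 + Λ w.2 := by
    rw [h1, h2.fderiv]
    rfl
  rw [energyL_eq_fibre hL₁, energyL_eq_fibre hL₂, h3, h4]
  ring

/-! ### Necessity -/

theorem GaugeEquivalent.exists_eq_add_hat [FiniteDimensional ℝ E] [T2Space Q] [ParacompactSpace Q]
    [ConnectedSpace Q] (hk : 1 ≤ k) (hL₁ : ContMDiff (velocityModel k E) 𝓘(ℝ, ℝ) ∞ L₁)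
    (hL₂ : ContMDiff (velocityModel k E) 𝓘(ℝ, ℝ) ∞ L₂) (hreg : IsRegular L₁)
    (h : GaugeEquivalent L₁ L₂) :
    ∃ α : Fin k → (q : Q) → TangentSpace 𝓘(ℝ, E) q →L[ℝ] ℝ,
      (∀ A, IsSmoothForm (α A)) ∧ (∀ A q, extDer 𝓘(ℝ, E) (α A) q = 0) ∧
        ∃ c : ℝ, ∀ w, L₁ w = L₂ w + hat α w + c := by
  set f : VelocityBundle k E Q → ℝ := fun z => L₁ z - L₂ z with hfdef
  have hf : ContMDiff (velocityModel k E) 𝓘(ℝ, ℝ) ∞ f := hL₁.sub hL₂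
  have hsymm := fun A => (omegaL_eq_iff hL₁ hL₂ A).1 (h.omega_eq A)
  have haff := eq_hat_fibreForm_add hf fun q v u u' =>
    fibreHessian_eq_zero hf (fibreIncl q v) v (fun A => hsymm A (fibreIncl q v)) u u'
  have hE : ∀ w, energyL L₂ w - energyL L₁ w = f (fibreIncl w.1 0) := fun w => by
    rw [energyL_eq_sub_of_affine hL₁ hL₂ (fibreForm f) w (f (fibreIncl w.1 0)) fun v => by
      rw [add_assoc, ← haff w.1 v]
      simp [hfdef]]
    ring
  obtain ⟨Γ, hΓ⟩ := solutionFields_nonempty hk hL₁ hreg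
  have hΓ₂ : Γ ∈ solutionFields L₂ := h.solutionFields_eq ▸ hΓ
  -- Both differentials equal `∑ i(Γ_A) ω^A` for the common solution `Γ`.
  have hdE : ∀ w, differential (energyL L₁) w = differential (energyL L₂) w := fun w =>
    ContinuousLinearMap.ext fun Z => by
      rw [← hΓ.2 w Z, ← hΓ₂.2 w Z]
      exact Finset.sum_congr rfl fun A _ => by rw [h.omega_eq A]
  have hd : ∀ w, HasMFDerivAt (velocityModel k E) 𝓘(ℝ, ℝ)
      (fun w => energyL L₂ w - energyL L₁ w) w 0 := fun w => by
    have h1 := ((contMDiff_energyL hL₂).mdifferentiable (by simp) w).hasMFDerivAt.sub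
      ((contMDiff_energyL hL₁).mdifferentiable (by simp) w).hasMFDerivAt
    have h2 : differential (energyL L₂) w - differential (energyL L₁) w = 0 := by
      rw [hdE, sub_self]
    exact (h2 ▸ h1 :)
  -- The energy difference is the pullback of `g` to `T¹ₖQ`; composing with the zero section
  -- recovers `g` with zero derivative.
  have hg : ∀ q, HasMFDerivAt 𝓘(ℝ, E) 𝓘(ℝ, ℝ) (fun q : Q => f (fibreIncl q 0)) q 0 := fun q => by
    have h0 : MDifferentiableAt 𝓘(ℝ, E) (velocityModel k E)
        (zeroSection (Fin k → E) (VelocitySpace k E : Q → Type _)) q :=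
      mdifferentiableAt_zeroSection ℝ (VelocitySpace k E)
    have h1 := (hd (zeroSection (Fin k → E) (VelocitySpace k E : Q → Type _) q)).comp q
      h0.hasMFDerivAt
    have h2 : (fun w => energyL L₂ w - energyL L₁ w) ∘
        (zeroSection (Fin k → E) (VelocitySpace k E : Q → Type _)) =
        fun q : Q => f (fibreIncl q 0) := funext fun q => hE _
    rw [h2, ContinuousLinearMap.zero_comp] at h1
    exact h1
  obtain ⟨q₀⟩ : Nonempty Q := inferInstance
  refine ⟨fibreForm f, fun A => isSmoothForm_of_chartForm fun q =>
    contDiffOn_chartForm_fibreForm hf q A, fun A q => extDer_fibreForm_eq_zero hf A q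
      (hsymm A (fibreIncl q 0)), f (fibreIncl q₀ 0), fun w => ?_⟩
  have h1 := haff w.1 w.2
  have h2 : f (fibreIncl w.1 0) = f (fibreIncl q₀ 0) :=
    eq_of_mfderiv_eq_zero (fun q => (hg q).mdifferentiableAt) (fun q => (hg q).mfderiv) w.1 q₀
  rw [h2] at h1
  have h3 : L₁ w - L₂ w = hat (fibreForm f) w + f (fibreIncl q₀ 0) := h1
  rw [add_assoc, ← h3]
  ring

/-! ### Sufficiency -/

theorem chartFun_hat_add_const (α : Fin k → (q : Q) → TangentSpace 𝓘(ℝ, E) q →L[ℝ] ℝ) (c : ℝ)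
    {w : VelocityBundle k E Q} {p : E × (Fin k → E)}
    (hp : p.1 ∈ (extChartAt 𝓘(ℝ, E) w.1).target) :
    chartFun (velocityModel k E) (fun z => hat α z + c) w p =
      ∑ A, chartForm 𝓘(ℝ, E) (α A) w.1 p.1 (p.2 A) + c := by
  rw [chartFun, velocityChart_symm_apply hp]
  rfl

/-- `α̂ + c` is affine in the velocities, so its derivative in the `A`-th velocity is the
coefficient `α^A`, independent of the velocity. -/
theorem fderiv_chartFun_hat_comp_vertEndo
    {α : Fin k → (q : Q) → TangentSpace 𝓘(ℝ, E) q →L[ℝ] ℝ} {c : ℝ}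
    (hf : ContMDiff (velocityModel k E) 𝓘(ℝ, ℝ) ∞ fun z : VelocityBundle k E Q => hat α z + c)
    {w : VelocityBundle k E Q} {p : E × (Fin k → E)}
    (hp : p.1 ∈ (extChartAt 𝓘(ℝ, E) w.1).target) (A : Fin k) :
    (fderiv ℝ (chartFun (velocityModel k E) (fun z => hat α z + c) w) p).comp (vertEndo k E A) =
      (chartForm 𝓘(ℝ, E) (α A) w.1 p.1).comp (ContinuousLinearMap.fst ℝ E (Fin k → E)) := by
  obtain ⟨y, v⟩ := p
  let Λ : (Fin k → E) →L[ℝ] ℝ :=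
    ∑ A, (chartForm 𝓘(ℝ, E) (α A) w.1 y).comp (ContinuousLinearMap.proj A)
  have hd := ((contDiffAt_chartFun hf (mem_velocityChart_target.2 hp)).differentiableAt
    (by simp)).hasFDerivAt.comp v (hasFDerivAt_prodMk_right _ v)
  have h1 : chartFun (velocityModel k E) (fun z => hat α z + c) w ∘ (fun v => (y, v)) =
      fun v => Λ v + c := funext fun v => by
    rw [Function.comp_apply, chartFun_hat_add_const α c (p := (y, v)) hp, sum_apply]
    rfl
  rw [h1] at hd
  have h2 := hd.unique (Λ.hasFDerivAt.add_const c)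
  refine ContinuousLinearMap.ext fun Z => ?_
  have h3 := DFunLike.congr_fun h2 (Pi.single A Z.1)
  refine h3.trans ?_
  rw [sum_apply, Finset.sum_eq_single A]
  · exact congrArg (chartForm 𝓘(ℝ, E) (α A) w.1 y)
      (Pi.single_eq_same (M := fun _ => E) A Z.1)
  · intro B _ hB
    exact (congrArg (chartForm 𝓘(ℝ, E) (α B) w.1 y)
      (Pi.single_eq_of_ne (M := fun _ => E) hB Z.1)).trans (map_zero _)
  · simp

/-- Both sides are derivatives of the local expression `a` of `α^A`, namely `Da(X.1)(Z.1)` and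
`Da(Z.1)(X.1)`; their difference is `dα^A(X.1, Z.1)`. -/
theorem fderiv_fderiv_chartFun_hat_symm
    {α : Fin k → (q : Q) → TangentSpace 𝓘(ℝ, E) q →L[ℝ] ℝ} {c : ℝ}
    (hf : ContMDiff (velocityModel k E) 𝓘(ℝ, ℝ) ∞ fun z : VelocityBundle k E Q => hat α z + c)
    (A : Fin k) (w : VelocityBundle k E Q) (hα : extDer 𝓘(ℝ, E) (α A) w.1 = 0)
    (v : Fin k → E)
    (X Z : E × (Fin k → E)) :
    fderiv ℝ (fderiv ℝ (chartFun (velocityModel k E) (fun z => hat α z + c) w))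
        (extChartAt 𝓘(ℝ, E) w.1 w.1, v) X (vertEndo k E A Z) =
      fderiv ℝ (fderiv ℝ (chartFun (velocityModel k E) (fun z => hat α z + c) w))
        (extChartAt 𝓘(ℝ, E) w.1 w.1, v) Z (vertEndo k E A X) := by
  let a := chartForm 𝓘(ℝ, E) (α A) w.1
  let x₀ := extChartAt 𝓘(ℝ, E) w.1 w.1
  let C : E →L[ℝ] E × (Fin k → E) := (ContinuousLinearMap.inr ℝ E (Fin k → E)).comp
    (ContinuousLinearMap.single ℝ (fun _ : Fin k => E) A)
  have hG := contDiffAt_chartFun hf (mk_mem_velocityChart_target w v)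
  -- Differentiability of the coefficients is inherited from `α̂ + c`: they are its velocity
  -- derivatives on the slice of constant `v`.
  have ha : DifferentiableAt ℝ a x₀ := by
    have h1 : DifferentiableAt ℝ (fun y => (fderiv ℝ (chartFun (velocityModel k E)
        (fun z => hat α z + c) w) (y, v)).comp C) x₀ :=
      ((ContinuousLinearMap.compL ℝ E (E × (Fin k → E)) ℝ).flip C).differentiableAt.comp x₀
        (hG.differentiableAt_fderiv_infty.comp x₀
          (hasFDerivAt_prodMk_left x₀ v).differentiableAt)
    refine h1.congr_of_eventuallyEq ?_
    filter_upwards [extChartAt_target_mem_nhds (I := 𝓘(ℝ, E)) w.1] with y hy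
    refine ContinuousLinearMap.ext fun e => ?_
    exact (DFunLike.congr_fun (fderiv_chartFun_hat_comp_vertEndo hf (p := (y, v)) hy A)
      (e, 0)).symm
  have hev : (fun p => (fderiv ℝ (chartFun (velocityModel k E) (fun z => hat α z + c) w) p).comp
      (vertEndo k E A)) =ᶠ[𝓝 (x₀, v)]
      fun p => (a p.1).comp (ContinuousLinearMap.fst ℝ E (Fin k → E)) :=
    eventually_of_mem ((isOpen_extChartAt_target w).mem_nhds (mk_mem_velocityChart_target w v))
      fun p hp => fderiv_chartFun_hat_comp_vertEndo hf (mem_velocityChart_target.1 hp) A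
  have hval : ∀ X Z : E × (Fin k → E),
      fderiv ℝ (fderiv ℝ (chartFun (velocityModel k E) (fun z => hat α z + c) w))
        (x₀, v) X (vertEndo k E A Z) = fderiv ℝ a x₀ X.1 Z.1 := fun X Z => by
    rw [← fderiv_fderiv_comp_apply hG (vertEndo k E A) X Z, hev.fderiv_eq]
    have h1 := ((ContinuousLinearMap.compL ℝ (E × (Fin k → E)) E ℝ).flip
      (ContinuousLinearMap.fst ℝ E (Fin k → E))).hasFDerivAt.comp (x₀, v)
        (HasFDerivAt.comp (x₀, v) (g := a) ha.hasFDerivAt hasFDerivAt_fst)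
    have h2 : HasFDerivAt (fun p : E × (Fin k → E) =>
      (a p.1).comp (ContinuousLinearMap.fst ℝ E (Fin k → E))) _ (x₀, v) := h1
    rw [h2.fderiv]
    rfl
  have hclosed := extDer_apply_of_mem_source (mem_extChartAt_source w.1) ha X.1 Z.1
  rw [hα] at hclosed
  have h1 : (0 : ℝ) = fderiv ℝ a x₀ X.1 Z.1 - fderiv ℝ a x₀ Z.1 X.1 :=
    hclosed.trans (congrArg₂ (fun x z => fderiv ℝ a x₀ x z - fderiv ℝ a x₀ z x)
      (extChartDeriv_self w.1 X.1) (extChartDeriv_self w.1 Z.1))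
  exact (hval X Z).trans ((sub_eq_zero.1 h1.symm).trans (hval Z X).symm)

theorem gaugeEquivalent_of_eq_add_hat (hL₁ : ContMDiff (velocityModel k E) 𝓘(ℝ, ℝ) ∞ L₁)
    (hL₂ : ContMDiff (velocityModel k E) 𝓘(ℝ, ℝ) ∞ L₂)
    {α : Fin k → (q : Q) → TangentSpace 𝓘(ℝ, E) q →L[ℝ] ℝ}
    (hα : ∀ A q, extDer 𝓘(ℝ, E) (α A) q = 0) {c : ℝ} (h : ∀ w, L₁ w = L₂ w + hat α w + c) :
    GaugeEquivalent L₁ L₂ := by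
  have hsub : (fun z => L₁ z - L₂ z) = fun z => hat α z + c := funext fun z => by
    rw [h]
    ring
  have hf : ContMDiff (velocityModel k E) 𝓘(ℝ, ℝ) ∞
      fun z : VelocityBundle k E Q => hat α z + c := hsub ▸ hL₁.sub hL₂
  have homega : ∀ A, omegaL L₁ A = omegaL L₂ A := fun A => by
    rw [omegaL_eq_iff hL₁ hL₂, hsub]
    exact fun w X Z => fderiv_fderiv_chartFun_hat_symm hf A w (hα A w.1) w.2 X Z
  have hE : energyL L₁ = fun w => energyL L₂ w - c := funext fun w =>
    energyL_eq_sub_of_affine hL₁ hL₂ α w c fun v => h _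
  have hdE : ∀ w, differential (energyL L₁) w = differential (energyL L₂) w := fun w => by
    have h1 := ((contMDiff_energyL hL₂).mdifferentiable (by simp) w).hasMFDerivAt.sub
      (hasMFDerivAt_const (I := velocityModel k E) (I' := 𝓘(ℝ, ℝ)) c w)
    have h2 := h1.mfderiv
    refine Eq.trans ?_ (h2.trans (sub_zero _))
    rw [hE]
    rfl
  refine ⟨homega, ?_⟩
  ext Γ
  simp only [solutionFields, homega, hdE]

end KSymplectic

theorem mainTheorem9 {E : Type*} [NormedAddCommGroup E] [NormedSpace ℝ E] [FiniteDimensional ℝ E]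
    {Q : Type*} [TopologicalSpace Q] [ChartedSpace E Q] [IsManifold 𝓘(ℝ, E) ∞ Q]
    [T2Space Q] [ParacompactSpace Q] [ConnectedSpace Q]
    {k : ℕ} (hk : 1 ≤ k) (L₁ L₂ : KSymplectic.VelocityBundle k E Q → ℝ)
    (hL₁ : ContMDiff (KSymplectic.velocityModel k E) 𝓘(ℝ, ℝ) ∞ L₁)
    (hL₂ : ContMDiff (KSymplectic.velocityModel k E) 𝓘(ℝ, ℝ) ∞ L₂)
    (hreg₁ : KSymplectic.IsRegular L₁) (hreg₂ : KSymplectic.IsRegular L₂) :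
    KSymplectic.GaugeEquivalent L₁ L₂ ↔
      ∃ α : Fin k → (q : Q) → TangentSpace 𝓘(ℝ, E) q →L[ℝ] ℝ,
        (∀ A, KSymplectic.IsSmoothForm (α A)) ∧
        (∀ A q, KSymplectic.extDer 𝓘(ℝ, E) (α A) q = 0) ∧
        ∃ c : ℝ, ∀ w, L₁ w = L₂ w + KSymplectic.hat α w + c := by
  constructor
  · exact KSymplectic.GaugeEquivalent.exists_eq_add_hat hk hL₁ hL₂ hreg₁
  · rintro ⟨α, -, hα, c, h⟩
    exact KSymplectic.gaugeEquivalent_of_eq_add_hat hL₁ hL₂ hα h
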